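/- Let $N\ge 0$ and let $V=\{0,\dots,N-1\}^2$ label $n=N^2$ fermionic modes (row $r$, column $c$), with annihilation operators $a_\alpha$ satisfying the canonical anticommutation relations. Let $G=(V,E)$ be the $N\times N$ square lattice, in which two modes are adjacent iff they agree in one coordinate and differ by $1$ in the other. For arbitrary coefficients $c'_{\alpha\beta}\in\mathbb{C}$ consider $$H=\sum_{\{\alpha,\beta\}\in E}\big(a_\alpha^\dagger a_\beta+a_\beta^\dagger a_\alpha\big)+\sum_{\alpha,\beta\in V}c'_{\alpha\beta}\,a_\alpha^\dagger a_\alpha a_\beta^\dagger a_\beta .$$ For a bijection (fermionic enumeration scheme) $f:V\to\{0,\dots,n-1\}$ let $\overline{\mathrm{JW}}_f$ be the Jordan--Wigner transformation $a_\alpha\mapsto A_{f(\alpha)}$, $a^\dagger_\alpha\mapsto A_{f(\alpha)}^\dagger$, extended to products and sums, where $A_i=\big(\bigotimes_{k<i}\sigma_z\big)\otimes\tfrac12(\sigma_x+i\sigma_y)_i\otimes\mathbb{1}$ on $n$ qubits. Let $\mathrm{APV}(f)$ be the average, over all Pauli strings occurring with nonzero coefficient in the Pauli expansion of $\overline{\mathrm{JW}}_f(H)$,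 of the Pauli weight (the number of non-identity tensor factors), and let $C(f)=\sum_{\{\alpha,\beta\}\in E}|f(\alpha)-f(\beta)|$ be the edgesum of $f$. The Mitchison--Durbin pattern $f_{\mathrm M}$ is defined as follows. Let $x$ be the integer nearest to $N-\tfrac12\sqrt{2N^2-2N+\tfrac43}$ (replaced by $0$ if it is negative, which happens only for $N=0$). Labels $0,1,2,\dots$ are given out successively. (1) In the top-left $x\times x$ square: for $r=0,\dots,x-1$, first the first $r$ cells of row $r$ from left to right, then the first $r+1$ cells of column $r$ from top to bottom. (2) Rows $x,\dots,N-x-1$ of the first $x$ columns, row by row from left to right. (3) In the bottom-left $x\times x$ square: for $y=x,x-1,\dots,1$, the first $y$ cells of row $N-y$ from left to right; then the remaining cells of this square, column by column from left to right, each column from top to bottom. (4) The columns $x,\dots,N-x-1$, one after the other, each from top to bottom. (5) The last $x$ columns by the symmetry $f_{\mathrm M}(r,c)=N^2-1-f_{\mathrm M}(N-1-r,N-1-c)$. Then $f_{\mathrm M}$ is a well-defined enumeration scheme, and 1. for all coefficients $c'$, $\overline{\mathrm{JW}}_{f_{\mathrm M}}$ has minimum average Pauli weight: $\mathrm{APV}(f_{\mathrm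 M})\le\mathrm{APV}(f)$ for every enumeration scheme $f$; 2. $f_{\mathrm M}$ solves the edgesum problem for the $N\times N$ square lattice: $C(f_{\mathrm M})\le C(f)$ for every enumeration scheme $f$; 3. the two problems are equivalent: for all coefficients $c'$, an enumeration scheme minimises $\mathrm{APV}$ if and only if it minimises $C$. -/

import Mathlib

open scoped Matrix BigOperators

/-! ### Fermionic modes: the algebra of the canonical anticommutation relations -/

/-- Symbols for the annihilation and creation operators of the modes in `V`. -/
inductive LadderOp (V : Type) : Type
  | ann (α : V)
  | cre (α : V)

/-- The canonical anticommutation relations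
`{a_α, a_β} = 0`, `{a_α†, a_β†} = 0`, `{a_α, a_β†} = δ_{αβ}`. -/
inductive CARRel (V : Type) :
    FreeAlgebra ℂ (LadderOp V) → FreeAlgebra ℂ (LadderOp V) → Prop
  | ann_ann (α β : V) : CARRel V
      (FreeAlgebra.ι ℂ (.ann α) * FreeAlgebra.ι ℂ (.ann β) +
        FreeAlgebra.ι ℂ (.ann β) * FreeAlgebra.ι ℂ (.ann α)) 0
  | cre_cre (α β : V) : CARRel V
      (FreeAlgebra.ι ℂ (.cre α) * FreeAlgebra.ι ℂ (.cre β) +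
        FreeAlgebra.ι ℂ (.cre β) * FreeAlgebra.ι ℂ (.cre α)) 0
  | ann_cre_self (α : V) : CARRel V
      (FreeAlgebra.ι ℂ (.ann α) * FreeAlgebra.ι ℂ (.cre α) +
        FreeAlgebra.ι ℂ (.cre α) * FreeAlgebra.ι ℂ (.ann α)) 1
  | ann_cre_ne (α β : V) (h : α ≠ β) : CARRel V
      (FreeAlgebra.ι ℂ (.ann α) * FreeAlgebra.ι ℂ (.cre β) +
        FreeAlgebra.ι ℂ (.cre β) * FreeAlgebra.ι ℂ (.ann α)) 0

/-- The complex algebra of fermionic operators on the modes in `V`. -/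
abbrev CARAlgebra (V : Type) : Type := RingQuot (CARRel V)

/-- The annihilation operator `a_α`. -/
noncomputable def annOp {V : Type} (α : V) : CARAlgebra V :=
  RingQuot.mkAlgHom ℂ (CARRel V) (FreeAlgebra.ι ℂ (.ann α))

/-- The creation operator `a_α†`. -/
noncomputable def creOp {V : Type} (α : V) : CARAlgebra V :=
  RingQuot.mkAlgHom ℂ (CARRel V) (FreeAlgebra.ι ℂ (.cre α))

/-- The hopping term `a_α† a_β + a_β† a_α` of an edge `{α, β}`. -/
noncomputable def hoppingTerm {V : Type} : Sym2 V → CARAlgebra V :=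
  Sym2.lift ⟨fun α β => creOp α * annOp β + creOp β * annOp α, fun _ _ => add_comm _ _⟩

/-- The fermionic Hamiltonian with interaction graph `G`: one hopping term for each edge of `G`, and
local quartic terms `c' α β • a_α† a_α a_β† a_β` with arbitrary coefficients. As
`a_α† a_α a_α† a_α = a_α† a_α`, the terms with `α = β` are the self-interactions. -/
noncomputable def fermionHamiltonian {V : Type} [Fintype V] (G : SimpleGraph V)
    [Fintype G.edgeSet] (c' : V → V → ℂ) : CARAlgebra V :=
  ∑ e ∈ G.edgeFinset, hoppingTerm e +
    ∑ α, ∑ β, c' α β • (creOp α * annOp α * creOp β * annOp β)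

/-! ### Qubits and Pauli strings -/

/-- Operators on `n` qubits, in the computational basis of `(ℂ²)^{⊗ n}`. -/
abbrev QubitOp (n : ℕ) : Type := Matrix (Fin n → Fin 2) (Fin n → Fin 2) ℂ

/-- The tensor product `M 0 ⊗ M 1 ⊗ ⋯ ⊗ M (n - 1)` of one-qubit operators. -/
def tensorOp {n : ℕ} (M : Fin n → Matrix (Fin 2) (Fin 2) ℂ) : QubitOp n :=
  Matrix.of fun s t => ∏ k, M k (s k) (t k)

/-- Labels of the one-qubit Pauli matrices. -/
inductive Pauli : Type
  | I
  | X
  | Y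
  | Z
  deriving DecidableEq

instance Pauli.fintype : Fintype Pauli where
  elems := {.I, .X, .Y, .Z}
  complete := by intro p; cases p <;> simp

/-- The Pauli matrices `1`, `σ_x`, `σ_y`, `σ_z`. -/
def Pauli.toMatrix : Pauli → Matrix (Fin 2) (Fin 2) ℂ
  | .I => 1
  | .X => !![0, 1; 1, 0]
  | .Y => !![0, -Complex.I; Complex.I, 0]
  | .Z => !![1, 0; 0, -1]

/-- The Pauli string `P 0 ⊗ ⋯ ⊗ P (n - 1)`. -/
def pauliString {n : ℕ} (P : Fin n → Pauli) : QubitOp n :=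
  tensorOp fun k => (P k).toMatrix

/-- The weight of a Pauli string: the number of qubits on which it acts nontrivially. -/
def pauliWeight {n : ℕ} (P : Fin n → Pauli) : ℕ :=
  (Finset.univ.filter fun k => P k ≠ Pauli.I).card

/-- The coefficient of the Pauli string `P` in the expansion of `M` in the basis of Pauli strings
(which is orthogonal for the trace inner product, each string having squared norm `2 ^ n`). -/
noncomputable def pauliCoeff {n : ℕ} (M : QubitOp n) (P : Fin n → Pauli) : ℂ :=
  (pauliString P * M).trace / 2 ^ n

open Classical in
/-- The terms of a qubit Hamiltonian: the Pauli strings with nonzero coefficient. -/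
noncomputable def pauliTerms {n : ℕ} (M : QubitOp n) : Finset (Fin n → Pauli) :=
  Finset.univ.filter fun P => pauliCoeff M P ≠ 0

/-- The average Pauli weight of the terms of a qubit Hamiltonian. -/
noncomputable def averagePauliWeight {n : ℕ} (M : QubitOp n) : ℚ :=
  (∑ P ∈ pauliTerms M, (pauliWeight P : ℚ)) / (pauliTerms M).card

/-! ### The Jordan–Wigner transformation with a fermionic enumeration scheme -/

/-- `A_i = Z_0 ⋯ Z_{i-1} · ½ (σ_x + i σ_y)_i`. -/
noncomputable def jwOp {n : ℕ} (i : Fin n) : QubitOp n :=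
  tensorOp fun k =>
    if k < i then Pauli.Z.toMatrix
    else if k = i then (1 / 2 : ℂ) • (Pauli.X.toMatrix + Complex.I • Pauli.Y.toMatrix)
    else 1

theorem tensorOp_mul {n : ℕ} (M M' : Fin n → Matrix (Fin 2) (Fin 2) ℂ) :
    tensorOp M * tensorOp M' = tensorOp fun k => M k * M' k := by
  ext s t
  simp only [tensorOp, Matrix.mul_apply, Matrix.of_apply]
  rw [Finset.prod_univ_sum]
  simp [Finset.prod_mul_distrib]

theorem tensorOp_one {n : ℕ} : tensorOp (fun _ : Fin n => 1) = 1 := by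
  ext s t
  simp only [tensorOp, Matrix.of_apply, Matrix.one_apply]
  by_cases h : s = t
  · simp [h]
  · rw [if_neg h]
    obtain ⟨k, hk⟩ := Function.ne_iff.mp h
    exact Finset.prod_eq_zero (Finset.mem_univ k) (by simp [hk])

theorem tensorOp_conjTranspose {n : ℕ} (M : Fin n → Matrix (Fin 2) (Fin 2) ℂ) :
    (tensorOp M)ᴴ = tensorOp fun k => (M k)ᴴ := by
  ext s t
  simp [tensorOp, Matrix.conjTranspose_apply]

theorem tensorOp_add {n : ℕ} (i : Fin n) (M M' M'' : Fin n → Matrix (Fin 2) (Fin 2) ℂ)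
    (hi : M i + M' i = M'' i) (h : ∀ k, k ≠ i → M k = M'' k) (h' : ∀ k, k ≠ i → M' k = M'' k) :
    tensorOp M + tensorOp M' = tensorOp M'' := by
  ext s t
  simp only [tensorOp, Matrix.add_apply, Matrix.of_apply]
  rw [← Finset.mul_prod_erase _ _ (Finset.mem_univ i),
    ← Finset.mul_prod_erase _ (fun k => M' k (s k) (t k)) (Finset.mem_univ i),
    ← Finset.mul_prod_erase _ (fun k => M'' k (s k) (t k)) (Finset.mem_univ i), ← hi,
    Finset.prod_congr rfl (g := fun k => M'' k (s k) (t k))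
      (fun k hk => by rw [h k (Finset.ne_of_mem_erase hk)]),
    Finset.prod_congr (f := fun k => M' k (s k) (t k)) rfl (g := fun k => M'' k (s k) (t k))
      (fun k hk => by rw [h' k (Finset.ne_of_mem_erase hk)]), Matrix.add_apply, add_mul]

theorem tensorOp_eq_zero {n : ℕ} (i : Fin n) (M : Fin n → Matrix (Fin 2) (Fin 2) ℂ)
    (hi : M i = 0) : tensorOp M = 0 := by
  ext s t
  exact Finset.prod_eq_zero (Finset.mem_univ i) (by simp [hi])

theorem jw_site :
    (1 / 2 : ℂ) • (Pauli.X.toMatrix + Complex.I • Pauli.Y.toMatrix) = !![0, 1; 0, 0] := by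
  ext i j
  fin_cases i <;> fin_cases j <;> simp [Pauli.toMatrix] <;> norm_num

theorem jwOp_eq {n : ℕ} (i : Fin n) :
    jwOp i = tensorOp fun k =>
      if k < i then !![1, 0; 0, -1] else if k = i then !![0, 1; 0, 0] else 1 := by
  unfold jwOp
  rw [jw_site]
  rfl

theorem jwOp_conjTranspose {n : ℕ} (i : Fin n) :
    (jwOp i)ᴴ = tensorOp fun k =>
      if k < i then !![1, 0; 0, -1] else if k = i then !![0, 0; 1, 0] else 1 := by
  rw [jwOp_eq, tensorOp_conjTranspose]
  congr 1
  ext k : 1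
  split_ifs
  · ext a b; fin_cases a <;> fin_cases b <;> simp
  · ext a b; fin_cases a <;> fin_cases b <;> simp
  · simp

theorem jwSite_anticomm {n : ℕ} (i j : Fin n) (hij : i < j)
    (S B C : Matrix (Fin 2) (Fin 2) ℂ) (hB : B * S + S * B = 0) :
    tensorOp (fun k => if k < i then S else if k = i then B else 1) *
        tensorOp (fun k => if k < j then S else if k = j then C else 1) +
      tensorOp (fun k => if k < j then S else if k = j then C else 1) *
        tensorOp (fun k => if k < i then S else if k = i then B else 1) = 0 := by
  rw [tensorOp_mul, tensorOp_mul]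
  set D : Fin n → Matrix (Fin 2) (Fin 2) ℂ := fun k =>
    if k = i then 0 else
      (if k < i then S else if k = i then B else 1) *
        (if k < j then S else if k = j then C else 1) with hD
  rw [tensorOp_add i _ _ D, tensorOp_eq_zero i D (by simp [hD])]
  · simp [hD, hij, hB]
  · intro k hk
    simp [hD, hk]
  · intro k hk
    simp only [hD, hk, if_false]
    split_ifs <;> first | rfl | simp | (exfalso; omega)

theorem jwSite_self {n : ℕ} (i : Fin n) (S B C R : Matrix (Fin 2) (Fin 2) ℂ)
    (hS : S * S = 1) (h : B * C + C * B = R) :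
    tensorOp (fun k => if k < i then S else if k = i then B else 1) *
        tensorOp (fun k => if k < i then S else if k = i then C else 1) +
      tensorOp (fun k => if k < i then S else if k = i then C else 1) *
        tensorOp (fun k => if k < i then S else if k = i then B else 1) =
      tensorOp (fun k => if k = i then R else 1) := by
  rw [tensorOp_mul, tensorOp_mul]
  apply tensorOp_add i
  · simp [h]
  · intro k hk
    simp only [hk, if_false]
    split_ifs <;> simp [hS]
  · intro k hk
    simp only [hk, if_false]
    split_ifs <;> simp [hS]

/-- The images of the generators: `a_α ↦ A_{f α}` and `a_α† ↦ A_{f α}†`. -/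
noncomputable def jwGen {V : Type} {n : ℕ} (f : V ≃ Fin n) : LadderOp V → QubitOp n
  | .ann α => jwOp (f α)
  | .cre α => (jwOp (f α))ᴴ

theorem jwGen_rel {V : Type} {n : ℕ} (f : V ≃ Fin n) ⦃x y : FreeAlgebra ℂ (LadderOp V)⦄
    (h : CARRel V x y) :
    FreeAlgebra.lift ℂ (jwGen f) x = FreeAlgebra.lift ℂ (jwGen f) y := by
  have hz : (!![1, 0; 0, -1] : Matrix (Fin 2) (Fin 2) ℂ) * !![1, 0; 0, -1] = 1 := by
    ext a b; fin_cases a <;> fin_cases b <;> simp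
  have h1 : (!![0, 1; 0, 0] : Matrix (Fin 2) (Fin 2) ℂ) * !![1, 0; 0, -1] +
      !![1, 0; 0, -1] * !![0, 1; 0, 0] = 0 := by
    ext a b; fin_cases a <;> fin_cases b <;> simp
  have h2 : (!![0, 0; 1, 0] : Matrix (Fin 2) (Fin 2) ℂ) * !![1, 0; 0, -1] +
      !![1, 0; 0, -1] * !![0, 0; 1, 0] = 0 := by
    ext a b; fin_cases a <;> fin_cases b <;> simp
  have h3 : (!![0, 1; 0, 0] : Matrix (Fin 2) (Fin 2) ℂ) * !![0, 1; 0, 0] +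
      !![0, 1; 0, 0] * !![0, 1; 0, 0] = 0 := by
    ext a b; fin_cases a <;> fin_cases b <;> simp
  have h4 : (!![0, 0; 1, 0] : Matrix (Fin 2) (Fin 2) ℂ) * !![0, 0; 1, 0] +
      !![0, 0; 1, 0] * !![0, 0; 1, 0] = 0 := by
    ext a b; fin_cases a <;> fin_cases b <;> simp
  have h5 : (!![0, 1; 0, 0] : Matrix (Fin 2) (Fin 2) ℂ) * !![0, 0; 1, 0] +
      !![0, 0; 1, 0] * !![0, 1; 0, 0] = 1 := by
    ext a b; fin_cases a <;> fin_cases b <;> simp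
  cases h with
  | ann_ann α β =>
    simp only [map_add, map_mul, FreeAlgebra.lift_ι_apply, jwGen, map_zero]
    rw [jwOp_eq, jwOp_eq]
    rcases lt_trichotomy (f α) (f β) with hl | he | hg
    · exact jwSite_anticomm _ _ hl _ _ _ h1
    · rw [he, jwSite_self _ _ _ _ _ hz h3, tensorOp_eq_zero (f β) _ (if_pos rfl)]
    · rw [add_comm]; exact jwSite_anticomm _ _ hg _ _ _ h1
  | cre_cre α β =>
    simp only [map_add, map_mul, FreeAlgebra.lift_ι_apply, jwGen, map_zero]
    rw [jwOp_conjTranspose, jwOp_conjTranspose]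
    rcases lt_trichotomy (f α) (f β) with hl | he | hg
    · exact jwSite_anticomm _ _ hl _ _ _ h2
    · rw [he, jwSite_self _ _ _ _ _ hz h4, tensorOp_eq_zero (f β) _ (if_pos rfl)]
    · rw [add_comm]; exact jwSite_anticomm _ _ hg _ _ _ h2
  | ann_cre_self α =>
    simp only [map_add, map_mul, FreeAlgebra.lift_ι_apply, jwGen, map_one]
    rw [jwOp_conjTranspose, jwOp_eq, jwSite_self _ _ _ _ _ hz h5]
    simp only [ite_self]
    exact tensorOp_one
  | ann_cre_ne α β hne =>
    simp only [map_add, map_mul, FreeAlgebra.lift_ι_apply, jwGen, map_zero]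
    rw [jwOp_conjTranspose, jwOp_eq]
    rcases lt_trichotomy (f α) (f β) with hl | he | hg
    · exact jwSite_anticomm _ _ hl _ _ _ h1
    · exact absurd (f.injective he) hne
    · rw [add_comm]; exact jwSite_anticomm _ _ hg _ _ _ h2

/-- The Jordan–Wigner transformation with fermionic enumeration scheme `f`: it sends `a_α` to
`A_{f α}` and `a_α†` to `A_{f α}†`, and products of fermionic operators to products. -/
noncomputable def jordanWigner {V : Type} {n : ℕ} (f : V ≃ Fin n) :
    CARAlgebra V →ₐ[ℂ] QubitOp n :=
  RingQuot.liftAlgHom ℂ ⟨FreeAlgebra.lift ℂ (jwGen f), jwGen_rel f⟩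

/-! ### The edgesum cost, the square lattice and the Mitchison–Durbin pattern -/

/-- The label difference `|f α - f β|` along an edge `{α, β}`. -/
def labelDiff {V : Type} {n : ℕ} (f : V ≃ Fin n) : Sym2 V → ℤ :=
  Sym2.lift ⟨fun α β => |((f α : ℕ) : ℤ) - ((f β : ℕ) : ℤ)|, fun _ _ => abs_sub_comm _ _⟩

/-- The edgesum of the enumeration scheme `f` of the vertices of `G`. -/
def edgesum {V : Type} {n : ℕ} (G : SimpleGraph V) [Fintype G.edgeSet] (f : V ≃ Fin n) : ℤ :=
  ∑ e ∈ G.edgeFinset, labelDiff f e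

/-- The `N × N` square lattice; `(r, c)` is the vertex in row `r` and column `c`. -/
abbrev squareLattice (N : ℕ) : SimpleGraph (Fin N × Fin N) :=
  SimpleGraph.pathGraph N □ SimpleGraph.pathGraph N

noncomputable instance squareLattice.fintypeEdgeSet (N : ℕ) :
    Fintype (squareLattice N).edgeSet := Fintype.ofFinite _

/-- The side length of the corner squares: the integer closest to
`N - ½ √(2N² - 2N + 4/3)`. -/
noncomputable def mdSide (N : ℕ) : ℕ :=
  (round ((N : ℝ) - 1 / 2 * √(2 * (N : ℝ) ^ 2 - 2 * N + 4 / 3))).toNat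

/-- Labels in the left block (columns `c < x`), for side length `x ≤ N / 2`.
The top `x × x` square is filled by growing squares: the first `r` cells of row `r`, then the
first `r + 1` cells of column `r`, for `r = 0, …, x - 1`. The next `N - 2x` rows are filled row by
row. In the bottom `x × x` square the row at height `y = N - r` above the bottom edge has its first
`y` cells filled, row by row from the top; then the remaining cells are filled column by column,
each from top to bottom. -/
def mdLeft (N x r c : ℕ) : ℕ :=
  if r < x then
    if c < r then r ^ 2 + c else c * (c + 1) + r
  else if r < N - x then
    r * x + c
  else if c < N - r then
    x * (N - x) + (x * (x + 1) / 2 - (N - r) * (N - r + 1) / 2) + c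
  else
    x * (N - x) + x * (x + 1) / 2 + c * (c - 1) / 2 + (r + c - N)

/-- The labels of the pattern with corner squares of side `x`: the left block, then the middle
columns, each filled from top to bottom, then the right block, which is the left block rotated by
180° with the order of the labels reversed. -/
def mdLabel (N x r c : ℕ) : ℕ :=
  if c < x then mdLeft N x r c
  else if c < N - x then c * N + r
  else N ^ 2 - 1 - mdLeft N x (N - 1 - r) (N - 1 - c)

/-- `f` is the Mitchison–Durbin enumeration of the `N × N` square lattice. -/
def IsMitchisonDurbin {N : ℕ} (f : Fin N × Fin N ≃ Fin (N ^ 2)) : Prop :=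
  ∀ r c : Fin N, (f (r, c) : ℕ) = mdLabel N (mdSide N) r c

/-! ### Pauli coefficients -/

/-! Pauli weight and edgesum. For an edge, the product of the two Jordan–Wigner operators gives
exactly the strings `X Z ⋯ Z X` and `Y Z ⋯ Z Y`, each of weight one more than the label difference.
The letters `X`, `Y` mark the endpoints of the edge, so strings of different edges never collide
(`hoppingString_inj`). The quartic terms are diagonal and produce only strings in `I`, `Z`; an
enumeration merely permutes their tensor factors. Hence the number of strings does not depend on
`f`, and their total weight is twice the edgesum plus a constant. The two orders on enumerations
therefore agree (`averagePauliWeight_le_iff`), and everything reduces to the edgesum.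

Lower bound. A label difference counts the thresholds `k` separating its two labels, so the edgesum
is the sum over `k` of the edge boundary of the set of labels below `k`. Sorting the rows of that
set by length gives a Young diagram, and the boundary is at least `a + b - p - q`: nonempty rows and
columns minus full rows and columns (`edgesum_ge`). The diagrams grow one cell at a time. Write this
quantity as `N` minus an early and a late deficit plus an excess. The early deficit is limited
because a diagram with `a + b ≤ i` has bounded area; the late one is the same statement for
complements. The excess is charged to the cell just added, each cell being charged once
(`DiagramGrowth.cellWeight_le`). With `x` the number of columns occupied when `a + b = N`, and `y`
the number of full rows when `p + q = N`, the resulting bound is `N (N ^ 2 - 1)` plus the mean of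
`sideCost N x` and `sideCost N y`.

Optimum. For `2 * x ≤ N`, `sideCost N x` is a cubic in `x` whose increments change sign at the
rounded root defining `mdSide` (`sideCost_min`, `mdSide_spec`). The pattern is monotone along rows
and columns, so its edgesum telescopes to boundary labels, and closed forms for these show that the
bound is attained (`edgesum_mdLabel`). -/

theorem trace_tensorOp {n : ℕ} (M : Fin n → Matrix (Fin 2) (Fin 2) ℂ) :
    (tensorOp M).trace = ∏ k, (M k).trace := by
  simp only [Matrix.trace, Matrix.diag_apply, tensorOp, Matrix.of_apply]
  rw [Finset.prod_univ_sum, Fintype.piFinset_univ]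

/-- The coefficient of a Pauli matrix in a one-qubit operator. -/
noncomputable def siteCoeff (p : Pauli) (A : Matrix (Fin 2) (Fin 2) ℂ) : ℂ :=
  (p.toMatrix * A).trace / 2

theorem pauliCoeff_tensorOp {n : ℕ} (M : Fin n → Matrix (Fin 2) (Fin 2) ℂ) (P : Fin n → Pauli) :
    pauliCoeff (tensorOp M) P = ∏ k, siteCoeff (P k) (M k) := by
  rw [pauliCoeff, pauliString, tensorOp_mul, trace_tensorOp]
  simp only [siteCoeff, Finset.prod_div_distrib, Finset.prod_const, Finset.card_univ,
    Fintype.card_fin]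

theorem pauliCoeff_add {n : ℕ} (M M' : QubitOp n) (P : Fin n → Pauli) :
    pauliCoeff (M + M') P = pauliCoeff M P + pauliCoeff M' P := by
  simp only [pauliCoeff, mul_add, Matrix.trace_add, add_div]

theorem pauliCoeff_sum {n : ℕ} {ι : Type*} (s : Finset ι) (M : ι → QubitOp n)
    (P : Fin n → Pauli) : pauliCoeff (∑ i ∈ s, M i) P = ∑ i ∈ s, pauliCoeff (M i) P := by
  simp only [pauliCoeff, Finset.mul_sum, Matrix.trace_sum, Finset.sum_div]

theorem pauliCoeff_smul {n : ℕ} (c : ℂ) (M : QubitOp n) (P : Fin n → Pauli) :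
    pauliCoeff (c • M) P = c * pauliCoeff M P := by
  simp only [pauliCoeff, Matrix.mul_smul, Matrix.trace_smul, smul_eq_mul, mul_div_assoc]

theorem siteCoeff_one (p : Pauli) : siteCoeff p 1 = if p = .I then 1 else 0 := by
  cases p <;> simp [siteCoeff, Pauli.toMatrix, Matrix.trace_fin_two]

theorem siteCoeff_Z (p : Pauli) : siteCoeff p !![1, 0; 0, -1] = if p = .Z then 1 else 0 := by
  cases p <;> simp [siteCoeff, Pauli.toMatrix, Matrix.trace_fin_two]

theorem siteCoeff_lower (p : Pauli) : siteCoeff p !![0, 0; 1, 0] = p.toMatrix 0 1 / 2 := by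
  cases p <;> simp [siteCoeff, Pauli.toMatrix, Matrix.trace_fin_two]

theorem siteCoeff_raise (p : Pauli) : siteCoeff p !![0, 1; 0, 0] = p.toMatrix 1 0 / 2 := by
  cases p <;> simp [siteCoeff, Pauli.toMatrix, Matrix.trace_fin_two]

/-! ### The terms of the transformed Hamiltonian -/

theorem jordanWigner_annOp {V : Type} {n : ℕ} (f : V ≃ Fin n) (α : V) :
    jordanWigner f (annOp α) = jwOp (f α) := by
  simp [jordanWigner, annOp, jwGen]

theorem jordanWigner_creOp {V : Type} {n : ℕ} (f : V ≃ Fin n) (α : V) :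
    jordanWigner f (creOp α) = (jwOp (f α))ᴴ := by
  simp [jordanWigner, creOp, jwGen]

/-- The occupation number operator on the qubit `v` if `v = α`, and the identity otherwise. -/
noncomputable def occupation {V : Type} [DecidableEq V] (α v : V) : Matrix (Fin 2) (Fin 2) ℂ :=
  if v = α then !![0, 0; 0, 1] else 1

theorem jwOp_conjTranspose_mul_self {n : ℕ} (i : Fin n) :
    (jwOp i)ᴴ * jwOp i = tensorOp (occupation i) := by
  rw [jwOp_conjTranspose, jwOp_eq, tensorOp_mul]
  congr 1
  ext k : 1
  unfold occupation
  rcases lt_trichotomy k i with h | h | h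
  · rw [if_pos h, if_pos h, if_neg h.ne]
    ext a b; fin_cases a <;> fin_cases b <;> simp
  · subst h
    simp only [lt_irrefl, if_false, if_true]
    ext a b; fin_cases a <;> fin_cases b <;> simp
  · simp [h.not_gt, h.ne']

section Terms

variable {V : Type} [Fintype V] [DecidableEq V] {n : ℕ}

/-- The Pauli coefficients of the quartic terms, as a function of strings on the modes. -/
noncomputable def quarticCoeff (c' : V → V → ℂ) (Q : V → Pauli) : ℂ :=
  ∑ α, ∑ β, c' α β * ∏ v, siteCoeff (Q v) (occupation α v * occupation β v)

theorem pauliCoeff_quartic (f : V ≃ Fin n) (c' : V → V → ℂ) (P : Fin n → Pauli) :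
    pauliCoeff (jordanWigner f
      (∑ α, ∑ β, c' α β • (creOp α * annOp α * creOp β * annOp β))) P =
      quarticCoeff c' (P ∘ f) := by
  simp only [map_sum, map_smul, map_mul, jordanWigner_annOp, jordanWigner_creOp, pauliCoeff_sum,
    pauliCoeff_smul, quarticCoeff]
  refine Finset.sum_congr rfl fun α _ => Finset.sum_congr rfl fun β _ => ?_
  rw [mul_assoc, jwOp_conjTranspose_mul_self, jwOp_conjTranspose_mul_self, tensorOp_mul,
    pauliCoeff_tensorOp, ← f.prod_comp]
  simp [occupation]

/-- Products of occupation operators are diagonal, hence trace-orthogonal to `X` and `Y` at the site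
`v`. -/
theorem quarticCoeff_eq_zero (c' : V → V → ℂ) (Q : V → Pauli) (v : V)
    (h : Q v = .X ∨ Q v = .Y) : quarticCoeff c' Q = 0 := by
  refine Finset.sum_eq_zero fun α _ => Finset.sum_eq_zero fun β _ => ?_
  rw [Finset.prod_eq_zero (Finset.mem_univ v), mul_zero]
  unfold occupation
  rcases h with h | h <;> rw [h] <;> split_ifs <;>
    simp [siteCoeff, Pauli.toMatrix, Matrix.trace_fin_two]

open Classical in
/-- The two Pauli strings `X Z ⋯ Z X` and `Y Z ⋯ Z Y` of the hopping term of the edge `e`. -/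
noncomputable def hoppingString (f : V ≃ Fin n) (e : Sym2 V) (b : Bool) (k : Fin n) : Pauli :=
  if ∃ v ∈ e, f v = k then bif b then .X else .Y
  else if (∃ u ∈ e, f u < k) ∧ ∃ v ∈ e, k < f v then .Z else .I

theorem hoppingString_mk (f : V ≃ Fin n) {α β : V} (h : f α < f β) (b : Bool) (k : Fin n) :
    hoppingString f s(α, β) b k =
      if k = f α ∨ k = f β then bif b then .X else .Y
      else if f α < k ∧ k < f β then .Z else .I := by
  have h1 : (∃ v ∈ s(α, β), f v = k) ↔ (k = f α ∨ k = f β) := by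
    simp [eq_comm]
  have h2 : ((∃ u ∈ s(α, β), f u < k) ∧ ∃ v ∈ s(α, β), k < f v) ↔ (f α < k ∧ k < f β) := by
    simp only [Sym2.mem_iff, exists_eq_or_imp, exists_eq_left]
    omega
  simp only [hoppingString, h1, h2]

/-- Away from `i` and `j` both products have the same factors: `Z * Z = 1` before `i`, `Z` strictly
between, `1` after `j`. At `i` and `j` the extra `Z` is absorbed by the raising or lowering matrix
with no sign, leaving the flip-flop term, which is half of `X ⊗ X + Y ⊗ Y`. -/
theorem pauliCoeff_hopping_of_lt {i j : Fin n} (h : i < j) (P S S' : Fin n → Pauli)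
    (hS : ∀ k, S k = if k = i ∨ k = j then .X else if i < k ∧ k < j then .Z else .I)
    (hS' : ∀ k, S' k = if k = i ∨ k = j then .Y else if i < k ∧ k < j then .Z else .I) :
    pauliCoeff ((jwOp i)ᴴ * jwOp j + (jwOp j)ᴴ * jwOp i) P =
      if P = S ∨ P = S' then 1 / 2 else 0 := by
  have hz : (!![1, 0; 0, -1] : Matrix (Fin 2) (Fin 2) ℂ) * !![1, 0; 0, -1] = 1 := by
    ext a b; fin_cases a <;> fin_cases b <;> simp
  have h1 : (!![0, 0; 1, 0] : Matrix (Fin 2) (Fin 2) ℂ) * !![1, 0; 0, -1] = !![0, 0; 1, 0] := by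
    ext a b; fin_cases a <;> fin_cases b <;> simp
  have h2 : (!![1, 0; 0, -1] : Matrix (Fin 2) (Fin 2) ℂ) * !![0, 1; 0, 0] = !![0, 1; 0, 0] := by
    ext a b; fin_cases a <;> fin_cases b <;> simp
  have hoff : ∀ k, k ≠ i → k ≠ j → ∀ B C : Matrix (Fin 2) (Fin 2) ℂ,
      siteCoeff (P k) ((if k < i then !![1, 0; 0, -1] else if k = i then B else 1) *
        (if k < j then !![1, 0; 0, -1] else if k = j then C else 1)) =
        if P k = S k then 1 else 0 := by
    intro k hki hkj B C
    rw [hS, if_neg (c := k = i ∨ k = j) (by tauto)]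
    rcases lt_or_gt_of_ne hki with hlt | hgt
    · rw [if_pos hlt, if_pos (hlt.trans h), hz, siteCoeff_one, if_neg (c := i < k ∧ k < j)
        (fun h' => h'.1.not_gt hlt)]
    · rw [if_neg hgt.not_gt, if_neg hki, one_mul]
      rcases lt_or_gt_of_ne hkj with hlt' | hgt'
      · rw [if_pos hlt', siteCoeff_Z, if_pos (c := i < k ∧ k < j) ⟨hgt, hlt'⟩]
      · rw [if_neg hgt'.not_gt, if_neg hkj, siteCoeff_one, if_neg (c := i < k ∧ k < j)
          (fun h' => h'.2.not_gt hgt')]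
  have hoff' : ∀ k, k ≠ i → k ≠ j → ∀ B C : Matrix (Fin 2) (Fin 2) ℂ,
      siteCoeff (P k) ((if k < j then !![1, 0; 0, -1] else if k = j then B else 1) *
        (if k < i then !![1, 0; 0, -1] else if k = i then C else 1)) =
        if P k = S k then 1 else 0 := by
    intro k hki hkj B C
    rw [← hoff k hki hkj C B]
    congr 1
    split_ifs <;> simp
  rw [jwOp_conjTranspose, jwOp_conjTranspose, jwOp_eq, jwOp_eq, pauliCoeff_add, tensorOp_mul,
    tensorOp_mul, pauliCoeff_tensorOp, pauliCoeff_tensorOp]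
  by_cases hP : ∀ k, k ≠ i → k ≠ j → P k = S k
  · rw [Finset.prod_eq_mul i j h.ne (fun k _ hk => by
        rw [hoff k hk.1 hk.2, if_pos (hP k hk.1 hk.2)]) (by simp) (by simp),
      Finset.prod_eq_mul i j h.ne (fun k _ hk => by
        rw [hoff' k hk.1 hk.2, if_pos (hP k hk.1 hk.2)]) (by simp) (by simp)]
    simp only [lt_irrefl, if_false, if_true, h, h.not_gt, h.ne', one_mul, mul_one, h1, h2,
      siteCoeff_lower, siteCoeff_raise]
    have e1 : P = S ↔ P i = .X ∧ P j = .X := by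
      constructor
      · rintro rfl; simp [hS]
      · rintro ⟨hi, hj⟩
        funext k
        by_cases hki : k = i
        · simp [hki, hi, hS]
        by_cases hkj : k = j
        · simp [hkj, hj, hS]
        exact hP k hki hkj
    have e2 : P = S' ↔ P i = .Y ∧ P j = .Y := by
      constructor
      · rintro rfl; simp [hS']
      · rintro ⟨hi, hj⟩
        funext k
        by_cases hki : k = i
        · simp [hki, hi, hS']
        by_cases hkj : k = j
        · simp [hkj, hj, hS']
        rw [hP k hki hkj, hS, hS']
        simp [hki, hkj]
    simp only [e1, e2]
    rcases P i <;> rcases P j <;> simp [Pauli.toMatrix] <;> ring_nf <;> simp <;> norm_num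
  · push Not at hP
    obtain ⟨k, hki, hkj, hk⟩ := hP
    rw [Finset.prod_eq_zero (Finset.mem_univ k) (by rw [hoff k hki hkj, if_neg hk]),
      Finset.prod_eq_zero (Finset.mem_univ k) (by rw [hoff' k hki hkj, if_neg hk]), add_zero,
      if_neg]
    rintro (rfl | rfl)
    · exact hk rfl
    · apply hk
      rw [hS, hS']
      simp [hki, hkj]

open Classical in
theorem pauliCoeff_hoppingTerm (f : V ≃ Fin n) {e : Sym2 V} (he : ¬ e.IsDiag) (P : Fin n → Pauli) :
    pauliCoeff (jordanWigner f (hoppingTerm e)) P =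
      if ∃ b, P = hoppingString f e b then 1 / 2 else 0 := by
  have key : ∀ α β, f α < f β → pauliCoeff (jordanWigner f (hoppingTerm s(α, β))) P =
      if ∃ b, P = hoppingString f s(α, β) b then 1 / 2 else 0 := by
    intro α β h
    have := pauliCoeff_hopping_of_lt h P (hoppingString f s(α, β) true)
      (hoppingString f s(α, β) false) (fun k => by simp [hoppingString_mk f h])
      (fun k => by simp [hoppingString_mk f h])
    simp only [hoppingTerm, Sym2.lift_mk, map_add, map_mul, jordanWigner_annOp,
      jordanWigner_creOp, this, Bool.exists_bool]
    congr 1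
    exact propext or_comm
  induction e with | _ α β
  rcases lt_trichotomy (f α) (f β) with h | h | h
  · exact key α β h
  · exact absurd (f.injective h) he
  · rw [Sym2.eq_swap]
    exact key β α h

theorem hoppingString_eq_XY (f : V ≃ Fin n) (e : Sym2 V) (b : Bool) (v : V) :
    (hoppingString f e b (f v) = .X ∨ hoppingString f e b (f v) = .Y) ↔ v ∈ e := by
  unfold hoppingString
  simp only [f.apply_eq_iff_eq, exists_eq_right]
  split_ifs with h1 h2
  · cases b <;> simp [h1]
  · simp [h1]
  · simp [h1]

/-- The sites carrying `X` or `Y` recover the edge, and the letter found there recovers `b`. So no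
coefficients of hopping strings can add up or cancel. -/
theorem hoppingString_inj (f : V ≃ Fin n) {e e' : Sym2 V} {b b' : Bool}
    (h : hoppingString f e b = hoppingString f e' b') : e = e' ∧ b = b' := by
  have he : e = e' := Sym2.ext fun v => by
    rw [← hoppingString_eq_XY f e b, ← hoppingString_eq_XY f e' b', h]
  refine ⟨he, ?_⟩
  subst he
  induction e with | _ α β
  have hα := congrFun h (f α)
  have : ∃ v ∈ s(α, β), f v = f α := ⟨α, by simp, rfl⟩
  simp only [hoppingString, this, if_true] at hα
  cases b <;> cases b' <;> simp at hα ⊢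

theorem pauliWeight_hoppingString (f : V ≃ Fin n) {e : Sym2 V} (he : ¬ e.IsDiag) (b : Bool) :
    (pauliWeight (hoppingString f e b) : ℤ) = labelDiff f e + 1 := by
  have key : ∀ α β, f α < f β →
      (pauliWeight (hoppingString f s(α, β) b) : ℤ) = labelDiff f s(α, β) + 1 := by
    intro α β h
    have hset : (Finset.univ.filter fun k => hoppingString f s(α, β) b k ≠ .I) =
        Finset.Icc (f α) (f β) := by
      ext k
      simp only [hoppingString_mk f h, Finset.mem_filter, Finset.mem_univ, true_and,
        Finset.mem_Icc]
      split_ifs with h1 h2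
      · cases b <;> simp <;> omega
      · simp; omega
      · simp; omega
    have hdiff : labelDiff f s(α, β) = |((f α : ℕ) : ℤ) - ((f β : ℕ) : ℤ)| := rfl
    rw [pauliWeight, hset, Fin.card_Icc, hdiff, abs_sub_comm, abs_of_nonneg (by omega)]
    omega
  induction e with | _ α β
  rcases lt_trichotomy (f α) (f β) with h | h | h
  · exact key α β h
  · exact absurd (f.injective h) he
  · rw [Sym2.eq_swap]
    exact key β α h

open Classical in
-- The function `φ` is arbitrary so that one statement yields both the number of terms (`φ = 1`) and
-- their total weight. The two families of strings are disjoint because quartic coefficients vanish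
-- on strings containing `X` or `Y`.
theorem sum_pauliTerms (f : V ≃ Fin n) (G : SimpleGraph V) [Fintype G.edgeSet] (c' : V → V → ℂ)
    (φ : (Fin n → Pauli) → ℚ) :
    ∑ P ∈ pauliTerms (jordanWigner f (fermionHamiltonian G c')), φ P =
      ∑ e ∈ G.edgeFinset, ∑ b, φ (hoppingString f e b) +
        ∑ Q ∈ Finset.univ.filter (fun Q => quarticCoeff c' Q ≠ 0), φ (Q ∘ f.symm) := by
  have hdiag : ∀ e ∈ G.edgeFinset, ¬ e.IsDiag := fun e he =>
    G.not_isDiag_of_mem_edgeSet (SimpleGraph.mem_edgeFinset.mp he)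
  have hcoeff : ∀ P, pauliCoeff (jordanWigner f (fermionHamiltonian G c')) P =
      ∑ e ∈ G.edgeFinset, (if ∃ b, P = hoppingString f e b then 1 / 2 else 0) +
        quarticCoeff c' (P ∘ f) := fun P => by
    rw [fermionHamiltonian, map_add, pauliCoeff_add, pauliCoeff_quartic, map_sum, pauliCoeff_sum]
    congr 1
    exact Finset.sum_congr rfl fun e he => pauliCoeff_hoppingTerm f (hdiag e he) P
  set hop : Finset (Fin n → Pauli) :=
    (G.edgeFinset ×ˢ (Finset.univ : Finset Bool)).image fun z => hoppingString f z.1 z.2 with hhop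
  set quart : Finset (Fin n → Pauli) :=
    (Finset.univ.filter fun Q => quarticCoeff c' Q ≠ 0).image fun Q => Q ∘ f.symm with hquart
  have hmem : ∀ P, P ∈ hop ↔ ∃ e ∈ G.edgeFinset, ∃ b, P = hoppingString f e b := fun P => by
    rw [hhop, Finset.mem_image]
    constructor
    · rintro ⟨z, hz, rfl⟩
      exact ⟨z.1, (Finset.mem_product.mp hz).1, z.2, rfl⟩
    · rintro ⟨e, he, b, rfl⟩
      exact ⟨(e, b), Finset.mem_product.mpr ⟨he, Finset.mem_univ b⟩, rfl⟩
  have hmem' : ∀ P, P ∈ quart ↔ quarticCoeff c' (P ∘ f) ≠ 0 := fun P => by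
    rw [hquart, Finset.mem_image]
    constructor
    · rintro ⟨Q, hQ, rfl⟩
      rw [Function.comp_assoc, Equiv.symm_comp_self, Function.comp_id]
      exact (Finset.mem_filter.mp hQ).2
    · intro h
      refine ⟨P ∘ f, Finset.mem_filter.mpr ⟨Finset.mem_univ _, h⟩, ?_⟩
      rw [Function.comp_assoc, Equiv.self_comp_symm, Function.comp_id]
  have hzero : ∀ P ∈ hop, quarticCoeff c' (P ∘ f) = 0 := fun P hP => by
    obtain ⟨e, -, b, rfl⟩ := (hmem P).mp hP
    induction e with | _ α β
    exact quarticCoeff_eq_zero c' _ α ((hoppingString_eq_XY f _ b α).mpr (by simp))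
  have hunion : pauliTerms (jordanWigner f (fermionHamiltonian G c')) = hop ∪ quart := by
    ext P
    rw [pauliTerms, Finset.mem_filter, hcoeff, Finset.mem_union]
    by_cases hP : P ∈ hop
    · obtain ⟨e, he, b, rfl⟩ := (hmem P).mp hP
      rw [hzero _ hP, add_zero, Finset.sum_eq_single_of_mem e he fun e' _ hne => if_neg ?_]
      · simp [hP]
      · rintro ⟨b', hb'⟩
        exact hne (hoppingString_inj f hb').1.symm
    · have : ∀ e ∈ G.edgeFinset,
          (if ∃ b, P = hoppingString f e b then (1 / 2 : ℂ) else 0) = 0 := fun e he =>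
        if_neg fun h => hP ((hmem P).mpr ⟨e, he, h⟩)
      rw [Finset.sum_eq_zero this, zero_add, hmem']
      simp [hP]
  have hdisj : Disjoint hop quart := Finset.disjoint_left.mpr fun P hP hP' =>
    (hmem' P).mp hP' (hzero P hP)
  rw [hunion, Finset.sum_union hdisj, hhop, hquart, Finset.sum_image, Finset.sum_product,
    Finset.sum_image]
  · intro Q _ Q' _ h
    simpa [Function.comp_assoc] using congrArg (· ∘ f) h
  · rintro ⟨e, b⟩ _ ⟨e', b'⟩ _ h
    obtain ⟨rfl, rfl⟩ := hoppingString_inj f h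
    rfl

open Classical in
-- On the right only `edgesum G f` depends on `f`.
theorem averagePauliWeight_jordanWigner (f : V ≃ Fin n) (G : SimpleGraph V) [Fintype G.edgeSet]
    (c' : V → V → ℂ) :
    averagePauliWeight (jordanWigner f (fermionHamiltonian G c')) =
      (2 * (edgesum G f + G.edgeFinset.card) +
        ∑ Q ∈ Finset.univ.filter (fun Q => quarticCoeff c' Q ≠ 0),
          ((Finset.univ.filter fun v => Q v ≠ Pauli.I).card : ℚ)) /
      (2 * G.edgeFinset.card + (Finset.univ.filter fun Q => quarticCoeff c' Q ≠ 0).card) := by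
  have hcard := sum_pauliTerms f G c' fun _ => 1
  have hsum := sum_pauliTerms f G c' fun P => (pauliWeight P : ℚ)
  rw [averagePauliWeight, hsum]
  simp only [Finset.sum_const, nsmul_eq_mul, mul_one, Finset.card_univ, Fintype.card_bool,
    Nat.cast_ofNat] at hcard
  rw [hcard, mul_comm (2 : ℚ) (G.edgeFinset.card : ℚ)]
  congr 2
  · have : ∀ e ∈ G.edgeFinset, ∑ b, (pauliWeight (hoppingString f e b) : ℚ) =
        2 * labelDiff f e + 2 := fun e he => by
      have h := fun b => pauliWeight_hoppingString f
        (G.not_isDiag_of_mem_edgeSet (SimpleGraph.mem_edgeFinset.mp he)) b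
      have h' : ∀ b, (pauliWeight (hoppingString f e b) : ℚ) = labelDiff f e + 1 := fun b => by
        exact_mod_cast h b
      rw [Fintype.sum_bool, h', h']
      ring
    rw [Finset.sum_congr rfl this, Finset.sum_add_distrib, ← Finset.mul_sum, edgesum]
    simp only [Finset.sum_const, nsmul_eq_mul, Int.cast_sum]
    ring
  · refine Finset.sum_congr rfl fun Q _ => ?_
    rw [pauliWeight]
    congr 1
    refine Finset.card_equiv f.symm fun k => ?_
    simp

/-- The average Pauli weight is minimised by the enumeration schemes of minimal edgesum. -/
theorem averagePauliWeight_le_iff (f g : V ≃ Fin n) (G : SimpleGraph V) [Fintype G.edgeSet]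
    (c' : V → V → ℂ) :
    averagePauliWeight (jordanWigner f (fermionHamiltonian G c')) ≤
        averagePauliWeight (jordanWigner g (fermionHamiltonian G c')) ↔
      edgesum G f ≤ edgesum G g := by
  rw [averagePauliWeight_jordanWigner, averagePauliWeight_jordanWigner]
  rcases G.edgeFinset.eq_empty_or_nonempty with h | h
  · simp [edgesum, h]
  · have : 0 < G.edgeFinset.card := h.card_pos
    rw [div_le_div_iff_of_pos_right (by positivity), add_le_add_iff_right,
      mul_le_mul_iff_right₀ two_pos, add_le_add_iff_right, Int.cast_le]

end Terms

/-! ### The growth of a Young diagram in a square -/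

/-- The largest area `s * t` of a rectangle with `s + t ≤ i` one of whose sides is at most `m`. -/
def areaBound (m i : ℕ) : ℕ := if i ≤ 2 * m then i * i / 4 else m * (i - m)

/-- For `i ≤ 2 * m` this is the arithmetic–geometric mean inequality; beyond that the cap `m` lies
below the balanced side `i / 2`, so the best rectangle is `m` by `i - m`. -/
theorem mul_le_areaBound {m a b i : ℕ} (h : a + b ≤ i) (hm : a ≤ m ∨ b ≤ m) :
    a * b ≤ areaBound m i := by
  unfold areaBound
  split_ifs with hi
  · rw [Nat.le_div_iff_mul_le (by norm_num)]
    zify at h ⊢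
    nlinarith [sq_nonneg ((a : ℤ) - b)]
  · push Not at hi
    obtain ⟨d, rfl⟩ : ∃ d, i = 2 * m + 1 + d := ⟨i - (2 * m + 1), by omega⟩
    rw [show 2 * m + 1 + d - m = m + 1 + d by omega]
    rcases hm with hm | hm
    · obtain ⟨e, rfl⟩ := Nat.exists_eq_add_of_le hm
      have hb : b ≤ a + 2 * e + 1 + d := by omega
      nlinarith [Nat.mul_le_mul_left a hb]
    · obtain ⟨e, rfl⟩ := Nat.exists_eq_add_of_le hm
      have ha : a ≤ b + 2 * e + 1 + d := by omega
      nlinarith [Nat.mul_le_mul_right b ha]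

/-- The bound for the total deficit `N - (s + t)` of diagrams with few rows `s` and columns `t`. -/
def earlyGain (N m : ℕ) : ℕ := ∑ i ∈ Finset.range N, areaBound m i

/-- Layer-cake summation: `N - s` counts the levels `i < N` with `s ≤ i`. At level `i`, every
contributing `k` satisfies `k ≤ α k * β k ≤ areaBound m i`, so there are at most `areaBound m i` of
them. -/
theorem sum_deficit_le {N K m : ℕ} {α β : ℕ → ℕ}
    (area : ∀ k, 1 ≤ k → k ≤ K → k ≤ α k * β k)
    (narrow : ∀ k, 1 ≤ k → k ≤ K → α k + β k < N → α k ≤ m ∨ β k ≤ m) :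
    ∑ k ∈ Finset.Icc 1 K, (N - (α k + β k)) ≤ earlyGain N m := by
  have h1 : ∀ s : ℕ, N - s = ∑ i ∈ Finset.range N, if s ≤ i then 1 else 0 := by
    intro s
    rw [← Finset.card_filter, show (Finset.range N).filter (s ≤ ·) = Finset.Ico s N by
      ext i; simp; omega, Nat.card_Ico]
  simp_rw [h1]
  rw [Finset.sum_comm]
  refine Finset.sum_le_sum fun i hi => ?_
  rw [← Finset.card_filter]
  calc _ ≤ (Finset.Icc 1 (areaBound m i)).card := by
        refine Finset.card_le_card fun k hk => ?_
        simp only [Finset.mem_filter, Finset.mem_Icc, Finset.mem_range] at hk hi ⊢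
        obtain ⟨⟨hk1, hk2⟩, hk3⟩ := hk
        exact ⟨hk1, (area k hk1 hk2).trans
          (mul_le_areaBound hk3 (narrow k hk1 hk2 (by omega)))⟩
    _ = areaBound m i := by simp

theorem exists_crossing {N n : ℕ} (hN : 2 ≤ N) {α β : ℕ → ℕ} (hn : 1 ≤ n)
    (hα : ∀ k l, 1 ≤ k → k ≤ l → l ≤ n → α k ≤ α l)
    (hβ : ∀ k l, 1 ≤ k → k ≤ l → l ≤ n → β k ≤ β l)
    (start : α 1 + β 1 ≤ 2)
    (step : ∀ k, 1 ≤ k → k + 1 ≤ n → α (k + 1) + β (k + 1) ≤ α k + β k + 1)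
    (pos : ∀ k, 1 ≤ k → k ≤ n → 0 < α k ∧ 0 < β k) (finish : N ≤ α n + β n) :
    ∃ x, 1 ≤ x ∧ x + 1 ≤ N ∧ ∀ k, 1 ≤ k → k ≤ n →
      (α k + β k ≤ N → α k + x ≤ N ∧ β k ≤ x) ∧ (N ≤ α k + β k → N ≤ α k + x ∧ x ≤ β k) := by
  classical
  have hex : ∃ k, 1 ≤ k ∧ N ≤ α k + β k := ⟨n, hn, finish⟩
  set k := Nat.find hex with hk
  obtain ⟨hk1, hkN⟩ : 1 ≤ k ∧ N ≤ α k + β k := Nat.find_spec hex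
  have hkn : k ≤ n := Nat.find_min' hex ⟨hn, finish⟩
  have hkeq : α k + β k = N := by
    rcases Nat.eq_or_lt_of_le hk1 with h | h
    · rw [← h] at hkN ⊢; omega
    · have := Nat.find_min hex (m := k - 1) (by omega)
      have := step (k - 1) (by omega) (by omega)
      rw [show k - 1 + 1 = k by omega] at this
      omega
  have hp := pos k hk1 hkn
  refine ⟨β k, hp.2, by omega, fun l hl hln => ?_⟩
  rcases le_total k l with h | h
  · have := hα k l hk1 h hln
    have := hβ k l hk1 h hln
    omega
  · have := hα l k hl h hkn
    have := hβ l k hl h hkn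
    omega

/-- `a`, `b`, `p`, `q` count the nonempty rows and columns, and the full rows and columns, of an
increasing sequence of Young diagrams in an `N × N` square; the `k`-th diagram has `k` cells, and
`(R k, C k)` is the cell added to it. -/
structure DiagramGrowth (N : ℕ) (a b p q R C : ℕ → ℕ) : Prop where
  a_mono : Monotone a
  b_mono : Monotone b
  p_mono : Monotone p
  q_mono : Monotone q
  a_le : ∀ k, a k ≤ N
  b_le : ∀ k, b k ≤ N
  p_le : ∀ k, p k ≤ N
  q_le : ∀ k, q k ≤ N
  open_one : a 1 + b 1 ≤ 2
  full_pred : 2 * N ≤ p (N ^ 2 - 1) + q (N ^ 2 - 1) + 2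
  open_step : ∀ k, 1 ≤ k → k < N ^ 2 → a (k + 1) + b (k + 1) ≤ a k + b k + 1
  full_step : ∀ k, k + 1 < N ^ 2 → p (k + 1) + q (k + 1) ≤ p k + q k + 1
  area : ∀ k, k ≤ N ^ 2 → k ≤ a k * b k
  coarea : ∀ k, k ≤ N ^ 2 → N ^ 2 ≤ k + (N - p k) * (N - q k)
  b_eq : ∀ k, 0 < p k → b k = N
  a_eq : ∀ k, 0 < q k → a k = N
  R_lt : ∀ k, k < N ^ 2 → R k < N
  C_lt : ∀ k, k < N ^ 2 → C k < N
  inj : ∀ k l, k < N ^ 2 → l < N ^ 2 → R k = R l → C k = C l → k = l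
  R_lt_a : ∀ k, k < N ^ 2 → R k < a (k + 1)
  C_lt_b : ∀ k, k < N ^ 2 → C k < b (k + 1)
  p_le_R : ∀ k, k < N ^ 2 → p k ≤ R k
  q_le_C : ∀ k, k < N ^ 2 → q k ≤ C k
  p_succ_le : ∀ k, k < N ^ 2 → p (k + 1) ≤ R k + 1
  q_succ_le : ∀ k, k < N ^ 2 → q (k + 1) ≤ C k + 1
  p_succ_le_of_lt : ∀ k, k < N ^ 2 → C k + 1 < N → p (k + 1) ≤ R k
  q_succ_le_of_lt : ∀ k, k < N ^ 2 → R k + 1 < N → q (k + 1) ≤ C k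
  q_pos : ∀ k, k < N ^ 2 → R k + 1 = N → 0 < q (k + 1)
  p_pos : ∀ k, k < N ^ 2 → C k + 1 = N → 0 < p (k + 1)

theorem DiagramGrowth.swap {N : ℕ} {a b p q R C : ℕ → ℕ} (h : DiagramGrowth N a b p q R C) :
    DiagramGrowth N b a q p C R where
  a_mono := h.b_mono
  b_mono := h.a_mono
  p_mono := h.q_mono
  q_mono := h.p_mono
  a_le := h.b_le
  b_le := h.a_le
  p_le := h.q_le
  q_le := h.p_le
  open_one := by have := h.open_one; omega
  full_pred := by have := h.full_pred; omega
  open_step k h1 h2 := by have := h.open_step k h1 h2; omega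
  full_step k h1 := by have := h.full_step k h1; omega
  area k hk := by have := h.area k hk; rwa [mul_comm]
  coarea k hk := by have := h.coarea k hk; rwa [mul_comm (N - q k)]
  b_eq := h.a_eq
  a_eq := h.b_eq
  R_lt := h.C_lt
  C_lt := h.R_lt
  inj k l hk hl h1 h2 := h.inj k l hk hl h2 h1
  R_lt_a := h.C_lt_b
  C_lt_b := h.R_lt_a
  p_le_R := h.q_le_C
  q_le_C := h.p_le_R
  p_succ_le := h.q_succ_le
  q_succ_le := h.p_succ_le
  p_succ_le_of_lt := h.q_succ_le_of_lt
  q_succ_le_of_lt := h.p_succ_le_of_lt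
  q_pos := h.p_pos
  p_pos := h.q_pos

/-- The excess `cut - N` available when the cell in row `i` and column `j` of a corner square of
side `x` is added. -/
def cornerWeight (x i j : ℕ) : ℕ := if i + 1 < x then min (i + 1) (x - j) else x - j - 1

def cornerCost (x : ℕ) : ℕ := ∑ i ∈ Finset.range x, ∑ j ∈ Finset.range x, cornerWeight x i j

/-- Lower bounds for the excess in all cells: the bottom left corner square of side `x`, the top
right one of side `y`, and the columns between them. -/
def cellWeight (N x y r c : ℕ) : ℕ :=
  (if N - x ≤ r then if c < x then cornerWeight x (r - (N - x)) c else 0 else 0) +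
  (if r < N - 1 then if c < N - y then if c < x then 0 else 1 else 0 else 0) +
  (if r < y then if N - y ≤ c then cornerWeight y (c - (N - y)) r else 0 else 0)

/-! ### Summing the cell weights and charging them to growth steps. -/

theorem sum_range_shift {N x : ℕ} (hx : x ≤ N) (g : ℕ → ℕ) :
    ∑ r ∈ Finset.range N, (if N - x ≤ r then g (r - (N - x)) else 0) =
      ∑ i ∈ Finset.range x, g i := by
  conv_lhs => rw [show N = (N - x) + x by omega]
  rw [Finset.sum_range_add, Finset.sum_eq_zero, zero_add]
  · refine Finset.sum_congr rfl fun i _ => ?_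
    rw [Nat.sub_add_cancel hx, if_pos (by omega)]
    congr 1; omega
  · intro i hi
    rw [Finset.mem_range] at hi
    rw [Nat.sub_add_cancel hx, if_neg (by omega)]

theorem sum_range_lt {N x : ℕ} (hx : x ≤ N) (g : ℕ → ℕ) :
    ∑ r ∈ Finset.range N, (if r < x then g r else 0) = ∑ i ∈ Finset.range x, g i := by
  rw [← Finset.sum_filter]
  congr 1
  ext i; simp; omega

theorem sum_cellWeight {N x y : ℕ} (hxy : x + y ≤ N) :
    ∑ r ∈ Finset.range N, ∑ c ∈ Finset.range N, cellWeight N x y r c =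
      cornerCost x + (N - x - y) * (N - 1) + cornerCost y := by
  simp only [cellWeight, Finset.sum_add_distrib]
  congr 1
  · congr 1
    · rw [cornerCost]
      conv_rhs => rw [← sum_range_shift (N := N) (by omega)]
      refine Finset.sum_congr rfl fun r _ => ?_
      split_ifs
      · exact sum_range_lt (by omega) _
      · simp
    · calc _ = ∑ r ∈ Finset.range N, (if r < N - 1 then N - x - y else 0) := by
            refine Finset.sum_congr rfl fun r _ => ?_
            split_ifs
            · rw [sum_range_lt (by omega) (fun c => if c < x then 0 else 1)]
              rw [Finset.sum_ite, Finset.sum_const_zero, zero_add, Finset.sum_const, smul_eq_mul,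
                mul_one, show (Finset.range (N - y)).filter (fun c => ¬ c < x) =
                  Finset.Ico x (N - y) by ext i; simp; omega, Nat.card_Ico]
              omega
            · simp
        _ = _ := by
            rw [sum_range_lt (by omega) (fun _ => N - x - y)]
            simp [mul_comm]
  · rw [cornerCost, Finset.sum_comm]
    conv_rhs => rw [← sum_range_shift (N := N) (by omega)]
    refine Finset.sum_congr rfl fun r _ => ?_
    split_ifs
    · exact sum_range_lt (by omega) (fun j => cornerWeight y (r - (N - y)) j)
    · simp

/-- The `N ^ 2` steps add distinct cells, so every cell is added exactly once and a sum over time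
becomes a sum over the square. -/
theorem DiagramGrowth.sum_comp {N : ℕ} {a b p q R C : ℕ → ℕ} (h : DiagramGrowth N a b p q R C)
    (w : ℕ → ℕ → ℕ) :
    ∑ k ∈ Finset.range (N ^ 2), w (R k) (C k) =
      ∑ r ∈ Finset.range N, ∑ c ∈ Finset.range N, w r c := by
  have hinj : Set.InjOn (fun k => (R k, C k)) (Finset.range (N ^ 2) : Set ℕ) := by
    intro k hk l hl hkl
    simp only [Finset.coe_range, Set.mem_Iio] at hk hl
    simp only [Prod.mk.injEq] at hkl
    exact h.inj k l hk hl hkl.1 hkl.2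
  have himg : (Finset.range (N ^ 2)).image (fun k => (R k, C k)) =
      Finset.range N ×ˢ Finset.range N := by
    refine Finset.eq_of_subset_of_card_le ?_ ?_
    · intro z hz
      obtain ⟨k, hk, rfl⟩ := Finset.mem_image.mp hz
      rw [Finset.mem_range] at hk
      simp [h.R_lt k hk, h.C_lt k hk]
    · rw [Finset.card_image_of_injOn hinj]
      simp [sq]
  rw [← Finset.sum_product', ← himg, Finset.sum_image hinj]

/-- Between the two crossings, a cell in row `i` and column `j` of the bottom left corner makes `a +
b` exceed `N` by at least `i + 1`. A full column forces `a = N`, and at most `j` columns are full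
then (`j + 1` if the cell is in the last row), which leaves `x - j` or `x - j - 1`. Full rows force
`b = N`, and their number, at most `y`, is absorbed by `x + y ≤ N`. The top right corner is the
transposed situation, and in the columns between, `b ≥ x + 1` gives an excess of one above the last
row. -/
theorem DiagramGrowth.cellWeight_le {N : ℕ} {a b p q R C : ℕ → ℕ}
    (h : DiagramGrowth N a b p q R C) {x y k : ℕ} (hx : 1 ≤ x) (hy : 1 ≤ y)
    (hxy : x + y ≤ N) (hk : k + 1 < N ^ 2)
    (h1 : a (k + 1) + b (k + 1) ≤ N → a (k + 1) + x ≤ N ∧ b (k + 1) ≤ x)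
    (h2 : N ≤ a (k + 1) + b (k + 1) → N ≤ a (k + 1) + x ∧ x ≤ b (k + 1))
    (h3 : N ≤ p (k + 1) + q (k + 1) → y ≤ p (k + 1) ∧ N ≤ q (k + 1) + y)
    (h4 : p (k + 1) + q (k + 1) ≤ N → p (k + 1) ≤ y ∧ q (k + 1) + y ≤ N)
    (h5 : N ≤ p k + q k → y ≤ p k ∧ N ≤ q k + y) :
    (cellWeight N x y (R k) (C k) : ℤ) ≤
      ((a (k + 1) : ℤ) + b (k + 1) - p (k + 1) - q (k + 1) - N) +
        ((N - (a (k + 1) + b (k + 1)) : ℕ) + (N - ((N - p (k + 1)) + (N - q (k + 1))) : ℕ)) := by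
  have k0 : k < N ^ 2 := by omega
  have e1 := h.R_lt k k0
  have e2 := h.C_lt k k0
  have e3 := h.R_lt_a k k0
  have e4 := h.C_lt_b k k0
  have e5 := h.p_le_R k k0
  have e6 := h.q_le_C k k0
  have e7 := h.p_succ_le k k0
  have e8 := h.q_succ_le k k0
  have e9 := h.p_succ_le_of_lt k k0
  have e10 := h.q_succ_le_of_lt k k0
  have e11 := h.q_pos k k0
  have e12 := h.p_pos k k0
  have e13 := h.b_eq (k + 1)
  have e14 := h.a_eq (k + 1)
  have e15 := h.full_step k hk
  have e16 := h.a_le (k + 1)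
  have e17 := h.b_le (k + 1)
  have e18 := h.p_le (k + 1)
  have e19 := h.q_le (k + 1)
  generalize a (k + 1) = a' at *
  generalize b (k + 1) = b' at *
  generalize p (k + 1) = p' at *
  generalize q (k + 1) = q' at *
  generalize p k = p₀ at *
  generalize q k = q₀ at *
  generalize R k = r at *
  generalize C k = c at *
  clear h k0 hk
  rcases lt_or_ge (a' + b') N with hpre | hmid
  -- Before the first crossing the diagram lies in the first `N - x` rows and `x` columns, where all
  -- weights vanish.
  · have hw : cellWeight N x y r c = 0 := by
      obtain ⟨f1, f2⟩ := h1 hpre.le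
      simp only [cellWeight]
      split_ifs <;> omega
    omega
  rcases lt_or_ge N (p' + q') with hpost | hmid'
  -- The position of the new cell is bounded below by the full rows and columns before the step. As
  -- `p + q` grows by at most one, the strict inequality after the step gives `N ≤ p₀ + q₀`, so `h5`
  -- applies.
  · have hw : cellWeight N x y r c = 0 := by
      obtain ⟨f1, f2⟩ := h5 (by omega)
      simp only [cellWeight]
      split_ifs <;> omega
    omega
  obtain ⟨f1, f2⟩ := h2 hmid
  obtain ⟨f3, f4⟩ := h4 hmid'
  clear h1 h2 h3 h4 h5
  have key : (cellWeight N x y r c : ℤ) ≤ (a' : ℤ) + b' - p' - q' - N := by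
    rcases lt_or_ge c x with hc | hc
    · rcases lt_or_ge r (N - x) with hr | hr
      · have hw : cellWeight N x y r c = 0 := by
          simp only [cellWeight]
          split_ifs <;> omega
        omega
      · have hw : cellWeight N x y r c = cornerWeight x (r - (N - x)) c := by
          simp only [cellWeight]
          split_ifs <;> omega
        rw [hw, cornerWeight]
        split_ifs <;> omega
    rcases lt_or_ge c (N - y) with hc' | hc'
    · have hw : cellWeight N x y r c = if r < N - 1 then 1 else 0 := by
        simp only [cellWeight]
        split_ifs <;> omega
      rw [hw]
      split_ifs <;> omega
    rcases lt_or_ge r y with hr | hr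
    · have hw : cellWeight N x y r c = cornerWeight y (c - (N - y)) r := by
        simp only [cellWeight]
        split_ifs <;> omega
      rw [hw, cornerWeight]
      split_ifs <;> omega
    · have hw : cellWeight N x y r c = 0 := by
        simp only [cellWeight]
        split_ifs <;> omega
      omega
  omega

theorem DiagramGrowth.sum_ge_of_crossing {N : ℕ} {a b p q R C : ℕ → ℕ}
    (h : DiagramGrowth N a b p q R C) (hN : 2 ≤ N) {x y : ℕ} (hx : 1 ≤ x) (hy : 1 ≤ y)
    (hxy : x + y ≤ N)
    (hab : ∀ k, 1 ≤ k → k ≤ N ^ 2 →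
      (a k + b k ≤ N → a k + x ≤ N ∧ b k ≤ x) ∧ (N ≤ a k + b k → N ≤ a k + x ∧ x ≤ b k))
    (hpq : ∀ k, k < N ^ 2 →
      (N ≤ p k + q k → y ≤ p k ∧ N ≤ q k + y) ∧ (p k + q k ≤ N → p k ≤ y ∧ q k + y ≤ N)) :
    (N : ℤ) * ((N : ℤ) ^ 2 - 1) + cornerCost x + cornerCost y + ((N : ℤ) - x - y) * (N - 1)
      - earlyGain N (min x (N - x)) - earlyGain N (min y (N - y)) ≤
      ∑ k ∈ Finset.Icc 1 (N ^ 2 - 1), ((a k : ℤ) + b k - p k - q k) := by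
  have hn : 4 ≤ N ^ 2 := by nlinarith
  have hpre : ∑ k ∈ Finset.Icc 1 (N ^ 2 - 1), (N - (a k + b k)) ≤ earlyGain N (min x (N - x)) := by
    refine sum_deficit_le (fun k _ hk => h.area k (by omega)) fun k hk1 hk2 hlt => ?_
    have := (hab k hk1 (by omega)).1 hlt.le
    omega
  -- The late deficit is the early deficit of the complements, which grow when time is reversed by
  -- `k ↦ N ^ 2 - k`.
  have hpost : ∑ k ∈ Finset.Icc 1 (N ^ 2 - 1), (N - ((N - p k) + (N - q k))) ≤
      earlyGain N (min y (N - y)) := by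
    calc _ = ∑ k ∈ Finset.Icc 1 (N ^ 2 - 1),
          (N - ((N - p (N ^ 2 - k)) + (N - q (N ^ 2 - k)))) := by
          refine Finset.sum_nbij' (fun k => N ^ 2 - k) (fun k => N ^ 2 - k) ?_ ?_ ?_ ?_ ?_
          all_goals intro k hk; rw [Finset.mem_Icc] at hk
          · rw [Finset.mem_Icc]; omega
          · rw [Finset.mem_Icc]; omega
          · omega
          · omega
          · rw [show N ^ 2 - (N ^ 2 - k) = k by omega]
      _ ≤ _ := by
          refine sum_deficit_le (α := fun k => N - p (N ^ 2 - k))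
            (β := fun k => N - q (N ^ 2 - k)) (fun k _ hk => ?_) fun k hk1 hk2 hlt => ?_
          · have := h.coarea (N ^ 2 - k) (by omega)
            omega
          · have := (hpq (N ^ 2 - k) (by omega)).1
            have := h.p_le (N ^ 2 - k)
            have := h.q_le (N ^ 2 - k)
            omega
  have hcells : ∑ k ∈ Finset.Icc 1 (N ^ 2 - 1), cellWeight N x y (R (k - 1)) (C (k - 1)) =
      cornerCost x + (N - x - y) * (N - 1) + cornerCost y := by
    rw [← sum_cellWeight hxy, ← h.sum_comp]
    -- The thresholds stop at `N ^ 2 - 1`, so the last cell added is never charged. It is the bottom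
    -- right corner, of weight zero.
    have hlast : cellWeight N x y (R (N ^ 2 - 1)) (C (N ^ 2 - 1)) = 0 := by
      have := h.full_pred
      have := h.p_le_R (N ^ 2 - 1) (by omega)
      have := h.q_le_C (N ^ 2 - 1) (by omega)
      have := h.R_lt (N ^ 2 - 1) (by omega)
      have := h.C_lt (N ^ 2 - 1) (by omega)
      simp only [cellWeight]
      split_ifs <;> omega
    conv_rhs => rw [show N ^ 2 = N ^ 2 - 1 + 1 by omega, Finset.sum_range_succ, hlast, add_zero]
    rw [Finset.range_eq_Ico, Finset.sum_Ico_eq_sum_range]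
    rw [show Finset.Icc 1 (N ^ 2 - 1) = Finset.Ico 1 (N ^ 2) by ext; simp; omega,
      Finset.sum_Ico_eq_sum_range]
    refine Finset.sum_congr (by simp) fun k _ => ?_
    rw [Nat.add_sub_cancel_left, zero_add]
  have hsum : ∑ k ∈ Finset.Icc 1 (N ^ 2 - 1),
        (cellWeight N x y (R (k - 1)) (C (k - 1)) : ℤ) ≤
      ∑ k ∈ Finset.Icc 1 (N ^ 2 - 1), (((a k : ℤ) + b k - p k - q k - N) +
        ((N - (a k + b k) : ℕ) + (N - ((N - p k) + (N - q k)) : ℕ))) := by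
    refine Finset.sum_le_sum fun k hk => ?_
    rw [Finset.mem_Icc] at hk
    have hab' := hab k hk.1 (by omega)
    have hpq' := hpq k (by omega)
    have hpq'' := hpq (k - 1) (by omega)
    obtain ⟨l, rfl⟩ : ∃ l, k = l + 1 := ⟨k - 1, by omega⟩
    rw [Nat.add_sub_cancel] at hpq'' ⊢
    exact h.cellWeight_le hx hy hxy (by omega) hab'.1 hab'.2 hpq'.1 hpq'.2 hpq''.1
  rw [Finset.sum_add_distrib, Finset.sum_add_distrib, Finset.sum_sub_distrib (g := fun _ => (N : ℤ)),
    ← Nat.cast_sum, ← Nat.cast_sum, ← Nat.cast_sum, hcells, Finset.sum_const, Nat.card_Icc,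
    nsmul_eq_mul] at hsum
  zify at hpre hpost
  have hc1 : ((N - x - y : ℕ) : ℤ) = (N : ℤ) - x - y := by omega
  have hc2 : ((N - 1 : ℕ) : ℤ) = (N : ℤ) - 1 := by omega
  have hc3 : ((N ^ 2 - 1 + 1 - 1 : ℕ) : ℤ) = (N : ℤ) ^ 2 - 1 := by
    rw [Nat.add_sub_cancel, Nat.cast_sub (by omega)]; simp
  push_cast [hc1, hc2] at hsum
  rw [show ((N ^ 2 - 1 : ℕ) : ℤ) = (N : ℤ) ^ 2 - 1 by simpa using hc3] at hsum
  linarith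

theorem DiagramGrowth.exists_sum_ge {N : ℕ} {a b p q R C : ℕ → ℕ}
    (h : DiagramGrowth N a b p q R C) (hN : 2 ≤ N) :
    ∃ x y, 1 ≤ x ∧ x + 1 ≤ N ∧ 1 ≤ y ∧ y + 1 ≤ N ∧
    (N : ℤ) * ((N : ℤ) ^ 2 - 1) + cornerCost x + cornerCost y + ((N : ℤ) - x - y) * (N - 1)
      - earlyGain N (min x (N - x)) - earlyGain N (min y (N - y)) ≤
      ∑ k ∈ Finset.Icc 1 (N ^ 2 - 1), ((a k : ℤ) + b k - p k - q k) := by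
  have hn : 4 ≤ N ^ 2 := by nlinarith
  obtain ⟨x, hx1, hxN, hx⟩ := exists_crossing (n := N ^ 2) hN (by omega)
    (fun k l _ hkl _ => h.a_mono hkl) (fun k l _ hkl _ => h.b_mono hkl) h.open_one
    (fun k hk hk' => h.open_step k hk (by omega))
    (fun k hk hk' => by
      have := h.area k hk'
      exact ⟨Nat.pos_of_ne_zero (by rintro h0; simp [h0] at this; omega),
        Nat.pos_of_ne_zero (by rintro h0; simp [h0] at this; omega)⟩)
    (by
      have := h.area (N ^ 2) le_rfl
      by_contra! hlt
      nlinarith [Nat.zero_le (a (N ^ 2)), Nat.zero_le (b (N ^ 2))])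
  -- The complements in reversed time satisfy the same hypotheses. Here `N - p + (N - q) = N` means
  -- `p + q = N`, so `y` is the number of full rows at that moment.
  obtain ⟨y, hy1, hyN, hy⟩ := exists_crossing (n := N ^ 2)
    (α := fun k => N - p (N ^ 2 - k)) (β := fun k => N - q (N ^ 2 - k)) hN (by omega)
    (fun k l _ hkl _ => by
      have := h.p_mono (show N ^ 2 - l ≤ N ^ 2 - k by omega)
      omega)
    (fun k l _ hkl _ => by
      have := h.q_mono (show N ^ 2 - l ≤ N ^ 2 - k by omega)
      omega)
    (by
      have := h.full_pred
      have := h.p_le (N ^ 2 - 1)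
      have := h.q_le (N ^ 2 - 1)
      omega)
    (fun k hk hk' => by
      have := h.full_step (N ^ 2 - (k + 1)) (by omega)
      rw [show N ^ 2 - (k + 1) + 1 = N ^ 2 - k by omega] at this
      have := h.p_le (N ^ 2 - k)
      have := h.q_le (N ^ 2 - k)
      have := h.p_le (N ^ 2 - (k + 1))
      have := h.q_le (N ^ 2 - (k + 1))
      omega)
    (fun k hk hk' => by
      have := h.coarea (N ^ 2 - k) (by omega)
      exact ⟨Nat.pos_of_ne_zero (by rintro h0; simp [h0] at this; omega),
        Nat.pos_of_ne_zero (by rintro h0; simp [h0] at this; omega)⟩)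
    (by
      have hp0 := h.p_le_R 0 (by omega)
      have hq0 := h.q_le_C 0 (by omega)
      have := h.coarea 0 (by omega)
      simp only [Nat.sub_self]
      by_contra! hlt
      nlinarith [Nat.zero_le (N - p 0), Nat.zero_le (N - q 0)])
  have hy' : ∀ k, k < N ^ 2 →
      (N ≤ p k + q k → y ≤ p k ∧ N ≤ q k + y) ∧ (p k + q k ≤ N → p k ≤ y ∧ q k + y ≤ N) := by
    intro k hk
    have hyk := hy (N ^ 2 - k) (by omega) (by omega)
    rw [show N ^ 2 - (N ^ 2 - k) = k by omega] at hyk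
    have := h.p_le k
    have := h.q_le k
    omega
  rcases le_total (x + y) N with hxy | hxy
  · exact ⟨x, y, hx1, hxN, hy1, hyN, h.sum_ge_of_crossing hN hx1 hy1 hxy hx hy'⟩
  -- Transposition replaces `x`, `y` by `N - x`, `N - y`, which restores the condition that the two
  -- corner squares fit side by side.
  · refine ⟨N - x, N - y, by omega, by omega, by omega, by omega, ?_⟩
    refine (h.swap.sum_ge_of_crossing hN (x := N - x) (y := N - y) (by omega) (by omega) (by omega)
      (fun k hk hk' => ?_) (fun k hk => ?_)).trans (le_of_eq ?_)
    · have := hx k hk hk'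
      omega
    · have := hy' k hk
      omega
    · exact Finset.sum_congr rfl fun k _ => by ring

/-! ### Optimising the side length -/

/-- Reflecting `j` turns the weights into `min (i + 1) (j + 1)`, except that the last row is one
smaller in each of its `x` cells. The sum of these minima is the sum of the first `x` positive
squares, one square for each L-shaped layer. -/
theorem six_mul_cornerCost (x : ℕ) :
    6 * (cornerCost x : ℤ) = x * (x + 1) * (2 * x + 1) - 6 * x := by
  have hmin : ∀ x : ℕ, 6 * ∑ i ∈ Finset.range x, ∑ j ∈ Finset.range x, min (i + 1) (j + 1) =
      x * (x + 1) * (2 * x + 1) := by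
    intro x
    induction x with
    | zero => simp
    | succ x ih =>
      have h1 : ∀ i ∈ Finset.range x, ∑ j ∈ Finset.range (x + 1), min (i + 1) (j + 1) =
          ∑ j ∈ Finset.range x, min (i + 1) (j + 1) + (i + 1) := by
        intro i hi
        rw [Finset.mem_range] at hi
        rw [Finset.sum_range_succ, min_eq_left (by omega : i + 1 ≤ x + 1)]
      have h2 : ∑ j ∈ Finset.range (x + 1), min (x + 1) (j + 1) =
          ∑ j ∈ Finset.range x, (j + 1) + (x + 1) := by
        rw [Finset.sum_range_succ, min_self]
        congr 1
        refine Finset.sum_congr rfl fun j hj => ?_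
        rw [Finset.mem_range] at hj
        omega
      have h3 : (∑ j ∈ Finset.range x, (j + 1)) * 2 = x * (x + 1) := by
        have := Finset.sum_range_id_mul_two (x + 1)
        rw [Finset.sum_range_succ'] at this
        simpa [mul_comm] using this
      rw [Finset.sum_range_succ, Finset.sum_congr rfl h1, Finset.sum_add_distrib, h2]
      nlinarith
  have hcorner : cornerCost x + x =
      ∑ i ∈ Finset.range x, ∑ j ∈ Finset.range x, min (i + 1) (j + 1) := by
    cases x with
    | zero => simp [cornerCost]
    | succ y =>
      have hsum : ∀ i, ∑ j ∈ Finset.range (y + 1), min (i + 1) (y + 1 - j) =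
          ∑ j ∈ Finset.range (y + 1), min (i + 1) (j + 1) := by
        intro i
        rw [← Finset.sum_range_reflect]
        refine Finset.sum_congr rfl fun j hj => ?_
        rw [Finset.mem_range] at hj
        congr 1
        omega
      rw [cornerCost, Finset.sum_range_succ, add_assoc]
      conv_rhs => rw [Finset.sum_range_succ]
      congr 1
      · refine Finset.sum_congr rfl fun i hi => ?_
        rw [Finset.mem_range] at hi
        simp_rw [cornerWeight, if_pos (show i + 1 < y + 1 by omega)]
        exact hsum i
      · rw [← hsum]
        simp_rw [cornerWeight, if_neg (show ¬ y + 1 < y + 1 by omega)]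
        calc ∑ j ∈ Finset.range (y + 1), (y + 1 - j - 1) + (y + 1)
            = ∑ j ∈ Finset.range (y + 1), ((y + 1 - j - 1) + 1) := by
              rw [Finset.sum_add_distrib]; simp
          _ = _ := by
              refine Finset.sum_congr rfl fun j hj => ?_
              rw [Finset.mem_range] at hj
              omega
  have := hmin x
  rw [← hcorner] at this
  zify at this
  linarith

theorem six_mul_earlyGain {N m : ℕ} (h : 2 * m ≤ N) :
    6 * (earlyGain N m : ℤ) = m * (m - 1) * (4 * m + 1) +
      m * (3 * N * (N - 1) - 6 * m * (2 * m - 1) - 6 * m * (N - 2 * m)) := by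
  obtain ⟨d, rfl⟩ := Nat.exists_eq_add_of_le h
  clear h
  induction d with
  | zero =>
    -- Up to `2 * m` the bounds are quarter squares, summed in pairs `l * l` and `l * (l + 1)`.
    have h1 : ∀ l, l ≤ m → 6 * (∑ i ∈ Finset.range (2 * l), areaBound m i : ℕ) =
        ((l : ℤ) * (l - 1) * (4 * l + 1)) := by
      intro l hl
      induction l with
      | zero => simp
      | succ l ih =>
        have e1 : areaBound m (2 * l) = l * l := by
          rw [areaBound, if_pos (by omega), show 2 * l * (2 * l) = 4 * (l * l) by ring,
            Nat.mul_div_cancel_left _ (by norm_num)]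
        have e2 : areaBound m (2 * l + 1) = l * (l + 1) := by
          rw [areaBound, if_pos (by omega),
            show (2 * l + 1) * (2 * l + 1) = 1 + 4 * (l * (l + 1)) by ring,
            Nat.add_mul_div_left _ _ (by norm_num)]
          simp
        rw [show 2 * (l + 1) = 2 * l + 1 + 1 by ring, Finset.sum_range_succ, Finset.sum_range_succ,
          e1, e2]
        have := ih (by omega)
        push_cast at this ⊢
        linarith
    have := h1 m le_rfl
    rw [earlyGain, add_zero, this]
    push_cast
    ring
  | succ d ih =>
    -- The two branches of `areaBound` agree at `d = 0`, so the linear formula holds from `2 * m`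
    -- on.
    have e : (areaBound m (2 * m + d) : ℤ) = m * (m + d) := by
      unfold areaBound
      split_ifs with hd
      · obtain rfl : d = 0 := by omega
        rw [show (2 * m + 0) * (2 * m + 0) = 4 * (m * m) by ring,
            Nat.mul_div_cancel_left _ (by norm_num)]
        push_cast; ring
      · rw [show 2 * m + d - m = m + d by omega]
        push_cast; ring
    rw [earlyGain, ← add_assoc, Finset.sum_range_succ, Nat.cast_add, e, ← earlyGain, mul_add, ih]
    push_cast
    ring

/-- Twice the part of the optimal edgesum that depends on the side length `x`. -/
def sideCost (N x : ℕ) : ℤ :=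
  2 * cornerCost x - 2 * earlyGain N (min x (N - x)) + ((N : ℤ) - 2 * x) * (N - 1)

theorem three_mul_sideCost {N x : ℕ} (h : 2 * x ≤ N) :
    3 * sideCost N x = (x : ℤ) * (x + 1) * (2 * x + 1) - 6 * x - (x * (x - 1) * (4 * x + 1) +
      x * (3 * N * (N - 1) - 6 * x * (2 * x - 1) - 6 * x * (N - 2 * x))) +
      3 * (N - 2 * x) * (N - 1) := by
  have h1 := six_mul_cornerCost x
  have h2 := six_mul_earlyGain h
  rw [sideCost, min_eq_left (by omega)]
  linarith

/-- The early gain depends only on `min x (N - x)` and cancels, so the claim compares corner costs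
and a linear term. -/
theorem sideCost_le_of_le {N x : ℕ} (h : N ≤ 2 * x) (hx : x + 1 ≤ N) :
    sideCost N (N - x) ≤ sideCost N x := by
  obtain ⟨k, rfl⟩ := Nat.exists_eq_add_of_le (show x ≤ N by omega)
  have hk : 1 ≤ k := by omega
  obtain ⟨d, rfl⟩ := Nat.exists_eq_add_of_le (show k ≤ x by omega)
  have h1 := six_mul_cornerCost (k + d)
  have h2 := six_mul_cornerCost k
  rw [sideCost, sideCost, Nat.add_sub_cancel_left, show k + d + k - k = k + d by omega,
    min_comm (k + d)]
  -- With `N = 2 * k + d` and `x = k + d`, this polynomial is three times the difference of the two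
  -- costs.
  have h3 : (0 : ℤ) ≤ d * (2 * (d : ℤ) ^ 2 + 3 * d * (2 * k - 1) + 6 * k * (k - 1) + 1) := by
    have : (1 : ℤ) ≤ k := by exact_mod_cast hk
    have h4 : (0 : ℤ) ≤ 3 * d * (2 * k - 1) := mul_nonneg (by positivity) (by linarith)
    have h5 : (0 : ℤ) ≤ 6 * k * ((k : ℤ) - 1) := mul_nonneg (by positivity) (by linarith)
    exact mul_nonneg (by positivity) (by positivity)
  push_cast at h1 h2 ⊢
  linarith

/-- The right side is half of `(2N² - 2N + 1) - (2N - 1 - 2x)²`, so its sign is decided by the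
comparison that appears in `sideCost_min`. -/
theorem sideCost_succ_sub {N x : ℕ} (h : 2 * (x + 1) ≤ N) :
    sideCost N (x + 1) - sideCost N x =
      -2 * (x : ℤ) ^ 2 + 4 * N * x - 2 * x - (N : ℤ) ^ 2 + N := by
  have h1 := three_mul_sideCost h
  have h2 := three_mul_sideCost (show 2 * x ≤ N by omega)
  push_cast at h1
  linarith

/-- The side length with `(2N - 1 - 2x)² ≤ 2N² - 2N + 1 ≤ (2N + 1 - 2x)²` is optimal. -/
theorem sideCost_min {N x y : ℕ} (hx : 2 * x ≤ N) (hy : 2 * y ≤ N)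
    (h1 : (2 * (N : ℤ) - 1 - 2 * x) ^ 2 ≤ 2 * (N : ℤ) ^ 2 - 2 * N + 1)
    (h2 : 2 * (N : ℤ) ^ 2 - 2 * N + 1 ≤ (2 * (N : ℤ) + 1 - 2 * x) ^ 2) :
    sideCost N x ≤ sideCost N y := by
  rcases le_total x y with hxy | hxy
  -- Going up from `x`, the nonnegative quantity `2N - 1 - 2(x + d)` shrinks with `d`, so by `h1`
  -- all increments are nonnegative.
  · obtain ⟨d, rfl⟩ := Nat.exists_eq_add_of_le hxy
    clear hxy
    induction d with
    | zero => rfl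
    | succ d ih =>
      refine (ih (by omega)).trans ?_
      have h3 := sideCost_succ_sub (N := N) (x := x + d) (by omega)
      have h4 : (0 : ℤ) ≤ d * ((2 * N - 2 * x - 1) + (N - 2 * x - 2 * d) + N) := by
        refine mul_nonneg (by positivity) ?_
        omega
      have h5 : 2 * ((x + d : ℕ) : ℤ) ≤ N := by omega
      push_cast at h3
      rw [← add_assoc]
      nlinarith
  -- Going down from `x`, the square in the increment only grows, so by `h2` all increments below
  -- `x` are nonpositive.
  · have key : ∀ d, d ≤ x → sideCost N x ≤ sideCost N (x - d) := by
      intro d hd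
      induction d with
      | zero => rfl
      | succ d ih =>
        refine (ih (by omega)).trans ?_
        have h3 := sideCost_succ_sub (N := N) (x := x - (d + 1)) (by omega)
        rw [show x - (d + 1) + 1 = x - d by omega] at h3
        have h4 : (2 * (N : ℤ) + 1 - 2 * x) ^ 2 ≤ (2 * (N : ℤ) - 1 - 2 * (x - (d + 1) : ℕ)) ^ 2 :=
          pow_le_pow_left₀ (by omega) (by omega) 2
        nlinarith
    simpa [Nat.sub_sub_self hxy] using key (x - y) (by omega)

/-! ### Row counts of an enumeration -/

def nonemptyRows {N : ℕ} (σ : Fin N → ℕ) : ℕ := (Finset.univ.filter fun r => 0 < σ r).card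

def fullRows {N : ℕ} (σ : Fin N → ℕ) : ℕ := (Finset.univ.filter fun r => σ r = N).card

def longestRow {N : ℕ} (σ : Fin N → ℕ) : ℕ := Finset.univ.sup σ

def shortestRow {N : ℕ} [NeZero N] (σ : Fin N → ℕ) : ℕ :=
  Finset.univ.inf' Finset.univ_nonempty σ

/-- The number of rows that are longer than the row `r`. -/
def rowRank {N : ℕ} (σ : Fin N → ℕ) (r : Fin N) : ℕ :=
  (Finset.univ.filter fun s => σ r < σ s).card

theorem le_longestRow {N : ℕ} (σ : Fin N → ℕ) (r : Fin N) : σ r ≤ longestRow σ :=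
  Finset.le_sup (Finset.mem_univ r)

theorem longestRow_le {N : ℕ} {σ : Fin N → ℕ} {m : ℕ} (h : ∀ r, σ r ≤ m) : longestRow σ ≤ m :=
  Finset.sup_le fun r _ => h r

theorem shortestRow_le {N : ℕ} [NeZero N] (σ : Fin N → ℕ) (r : Fin N) : shortestRow σ ≤ σ r :=
  Finset.inf'_le _ (Finset.mem_univ r)

theorem le_shortestRow {N : ℕ} [NeZero N] {σ : Fin N → ℕ} {m : ℕ} (h : ∀ r, m ≤ σ r) :
    m ≤ shortestRow σ :=
  Finset.le_inf' _ _ fun r _ => h r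

theorem exists_shortestRow {N : ℕ} [NeZero N] (σ : Fin N → ℕ) : ∃ r, shortestRow σ = σ r := by
  obtain ⟨r, _, h⟩ := Finset.exists_mem_eq_inf' (Finset.univ_nonempty (α := Fin N)) σ
  exact ⟨r, h⟩

theorem rowRank_lt {N : ℕ} (σ : Fin N → ℕ) (r : Fin N) : rowRank σ r < N := by
  calc rowRank σ r ≤ (Finset.univ.erase r).card :=
        Finset.card_le_card fun s hs => by
          simp only [Finset.mem_filter, Finset.mem_univ, true_and] at hs
          simp only [Finset.mem_erase, Finset.mem_univ, and_true]
          rintro rfl; exact lt_irrefl _ hs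
    _ < N := by
        have := r.isLt
        simp; omega

theorem le_rowRank_add_one {N : ℕ} {σ : Fin N → ℕ} {r : Fin N} (A : Finset (Fin N))
    (h : ∀ s ∈ A, s ≠ r → σ r < σ s) : A.card ≤ rowRank σ r + 1 := by
  calc A.card ≤ (insert r (Finset.univ.filter fun s => σ r < σ s)).card :=
        Finset.card_le_card fun s hs => by
          by_cases hsr : s = r
          · simp [hsr]
          · simp [h s hs hsr]
    _ ≤ _ := Finset.card_insert_le _ _

theorem rowRank_add_one_le {N : ℕ} {σ : Fin N → ℕ} {r : Fin N} (A : Finset (Fin N)) (hr : r ∈ A)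
    (h : ∀ s, σ r < σ s → s ∈ A) : rowRank σ r + 1 ≤ A.card := by
  rw [rowRank, ← Finset.card_insert_of_notMem (a := r) (by simp)]
  refine Finset.card_le_card fun s hs => ?_
  rcases Finset.mem_insert.mp hs with rfl | hs
  · exact hr
  · exact h s (by simpa using hs)

/-- Sorting the rows by decreasing length gives the diagrams. Growing a row adds a cell at the first
sorted position among rows of its length, which is `rowRank`; its column is the length before the
step. -/
theorem diagramGrowth_of_rowCounts {N : ℕ} [NeZero N] {ρ : ℕ → Fin N → ℕ} {row : ℕ → Fin N}
    (hmono : ∀ ⦃k l⦄, k ≤ l → ∀ r, ρ k r ≤ ρ l r) (hle : ∀ k r, ρ k r ≤ N)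
    (hsum : ∀ k, k ≤ N ^ 2 → ∑ r, ρ k r = k)
    (hrow : ∀ k, k < N ^ 2 → ρ (k + 1) (row k) = ρ k (row k) + 1)
    (hother : ∀ k, k < N ^ 2 → ∀ r, r ≠ row k → ρ (k + 1) r = ρ k r) :
    DiagramGrowth N (fun k => nonemptyRows (ρ k)) (fun k => longestRow (ρ k))
      (fun k => fullRows (ρ k)) (fun k => shortestRow (ρ k))
      (fun k => rowRank (ρ k) (row k)) (fun k => ρ k (row k)) := by
  have hN : 1 ≤ N := NeZero.one_le
  have hn : 1 ≤ N ^ 2 := Nat.one_le_pow _ _ hN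
  have hsucc : ∀ k, k < N ^ 2 → ∀ r, ρ (k + 1) r ≤ ρ k r + 1 := by
    intro k hk r
    by_cases h : r = row k
    · rw [h, hrow k hk]
    · rw [hother k hk r h]; omega
  have hC : ∀ k, k < N ^ 2 → ρ k (row k) < N := fun k hk => by
    have := hrow k hk
    have := hle (k + 1) (row k)
    omega
  constructor
  case a_mono =>
    intro k l hkl
    refine Finset.card_le_card fun r hr => ?_
    have := hmono hkl r
    simp only [Finset.mem_filter, Finset.mem_univ, true_and] at hr ⊢
    omega
  case b_mono =>
    intro k l hkl
    exact longestRow_le fun r => (hmono hkl r).trans (le_longestRow _ r)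
  case p_mono =>
    intro k l hkl
    refine Finset.card_le_card fun r hr => ?_
    have := hmono hkl r
    have := hle l r
    simp only [Finset.mem_filter, Finset.mem_univ, true_and] at hr ⊢
    omega
  case q_mono =>
    intro k l hkl
    exact le_shortestRow fun r => (shortestRow_le _ r).trans (hmono hkl r)
  case a_le => intro k; exact (Finset.card_le_univ _).trans (by simp)
  case b_le => intro k; exact longestRow_le (hle k)
  case p_le => intro k; exact (Finset.card_le_univ _).trans (by simp)
  case q_le => intro k; exact (shortestRow_le _ 0).trans (hle k 0)
  case open_one =>
    have h0 : ∀ r, ρ 0 r = 0 := by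
      have := hsum 0 (by omega)
      simpa using this
    have h1 : nonemptyRows (ρ 1) ≤ 1 := by
      rw [nonemptyRows, Finset.card_le_one_iff_subset_singleton]
      refine ⟨row 0, fun r hr => ?_⟩
      by_contra hne
      have := hother 0 (by omega) r (by simpa using hne)
      simp [this, h0] at hr
    have h2 : longestRow (ρ 1) ≤ 1 := longestRow_le fun r => by
      have := hsucc 0 (by omega) r
      rw [h0] at this
      exact this
    omega
  case full_pred =>
    have hfull : ∀ r, ρ (N ^ 2) r = N := by
      by_contra! hne
      obtain ⟨r, hr⟩ := hne
      have : ∑ r, ρ (N ^ 2) r < ∑ _r : Fin N, N :=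
        Finset.sum_lt_sum (fun s _ => hle _ s) ⟨r, Finset.mem_univ r, lt_of_le_of_ne (hle _ r) hr⟩
      rw [hsum _ le_rfl] at this
      simp [sq] at this
    have hs := hsucc (N ^ 2 - 1) (by omega)
    have ho := hother (N ^ 2 - 1) (by omega)
    rw [Nat.sub_add_cancel hn] at hs ho
    have h1 : N - 1 ≤ fullRows (ρ (N ^ 2 - 1)) := by
      calc N - 1 = (Finset.univ.erase (row (N ^ 2 - 1))).card := by simp
        _ ≤ _ := Finset.card_le_card fun r hr => by
          have := ho r (by simpa using hr)
          simp [← this, hfull]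
    have h2 : N - 1 ≤ shortestRow (ρ (N ^ 2 - 1)) := le_shortestRow fun r => by
      have := hs r
      rw [hfull] at this
      omega
    omega
  -- A cell that opens a new row has column zero, so it cannot lengthen the longest row once some
  -- row is nonempty. This needs `1 ≤ k`: the very first cell raises both counts.
  case open_step =>
    intro k hk1 hk
    by_cases h0 : ρ k (row k) = 0
    · have h1 : nonemptyRows (ρ (k + 1)) ≤ nonemptyRows (ρ k) + 1 := by
        calc _ ≤ (insert (row k) (Finset.univ.filter fun r => 0 < ρ k r)).card :=
              Finset.card_le_card fun r hr => by
                by_cases h : r = row k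
                · simp [h]
                · simp only [Finset.mem_filter, Finset.mem_univ, true_and, hother k hk r h] at hr
                  simp [hr]
          _ ≤ _ := Finset.card_insert_le _ _
      have h2 : 1 ≤ longestRow (ρ k) := by
        by_contra! hlt
        have : ∑ r, ρ k r = 0 := Finset.sum_eq_zero fun r _ => by
          have := le_longestRow (ρ k) r
          omega
        rw [hsum k hk.le] at this
        omega
      have h3 : longestRow (ρ (k + 1)) ≤ longestRow (ρ k) := longestRow_le fun r => by
        by_cases h : r = row k
        · rw [h, hrow k hk, h0]; omega
        · rw [hother k hk r h]; exact le_longestRow _ r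
      omega
    · have h1 : nonemptyRows (ρ (k + 1)) ≤ nonemptyRows (ρ k) :=
        Finset.card_le_card fun r hr => by
          by_cases h : r = row k
          · subst h
            simp only [Finset.mem_filter, Finset.mem_univ, true_and]
            omega
          · simpa [hother k hk r h] using hr
      have h2 : longestRow (ρ (k + 1)) ≤ longestRow (ρ k) + 1 := longestRow_le fun r =>
        (hsucc k hk r).trans (Nat.succ_le_succ (le_longestRow _ r))
      omega
  -- A cell that completes a row leaves another row incomplete unless it is the last cell of all,
  -- and then the minimum length does not rise. This is why `k + 1 < N ^ 2` is required.
  case full_step =>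
    intro k hk
    have hk' : k < N ^ 2 := by omega
    by_cases h0 : ρ k (row k) + 1 = N
    · have h1 : fullRows (ρ (k + 1)) ≤ fullRows (ρ k) + 1 := by
        calc _ ≤ (insert (row k) (Finset.univ.filter fun r => ρ k r = N)).card :=
              Finset.card_le_card fun r hr => by
                by_cases h : r = row k
                · simp [h]
                · simp only [Finset.mem_filter, Finset.mem_univ, true_and, hother k hk' r h] at hr
                  simp [hr]
          _ ≤ _ := Finset.card_insert_le _ _
      obtain ⟨s, hs, hsN⟩ : ∃ s, s ≠ row k ∧ ρ k s + 1 ≤ N := by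
        by_contra! hne
        have hfull : ∑ r, ρ (k + 1) r = ∑ _r : Fin N, N := Finset.sum_congr rfl fun r _ => by
          by_cases h : r = row k
          · rw [h, hrow k hk', h0]
          · have := hne r h
            have := hle k r
            rw [hother k hk' r h]; omega
        rw [hsum _ (by omega)] at hfull
        simp [sq] at hfull hk
        omega
      have h2 : shortestRow (ρ (k + 1)) ≤ shortestRow (ρ k) := by
        obtain ⟨r, hr⟩ := exists_shortestRow (ρ k)
        by_cases h : r = row k
        · have := shortestRow_le (ρ (k + 1)) s
          rw [hother k hk' s hs] at this
          rw [hr, h]; omega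
        · rw [hr, ← hother k hk' r h]
          exact shortestRow_le _ r
      omega
    · have h1 : fullRows (ρ (k + 1)) ≤ fullRows (ρ k) :=
        Finset.card_le_card fun r hr => by
          by_cases h : r = row k
          · subst h
            simp [hrow k hk', h0] at hr
          · simpa [hother k hk' r h] using hr
      have h2 : shortestRow (ρ (k + 1)) ≤ shortestRow (ρ k) + 1 := by
        obtain ⟨r, hr⟩ := exists_shortestRow (ρ k)
        rw [hr]
        exact (shortestRow_le _ r).trans (hsucc k hk' r)
      omega
  case area =>
    intro k hk
    calc k = ∑ r, ρ k r := (hsum k hk).symm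
      _ = ∑ r ∈ Finset.univ.filter (fun r => 0 < ρ k r), ρ k r := by
          rw [Finset.sum_filter]
          refine Finset.sum_congr rfl fun r _ => ?_
          split_ifs <;> omega
      _ ≤ _ := (Finset.sum_le_card_nsmul _ _ _ fun r _ => le_longestRow _ r).trans_eq
          (smul_eq_mul _ _)
  case coarea =>
    intro k hk
    have hnot : N - fullRows (ρ k) = (Finset.univ.filter fun r => ¬ ρ k r = N).card := by
      have := Finset.card_filter_add_card_filter_not (s := (Finset.univ : Finset (Fin N)))
        (fun r => ρ k r = N)
      rw [Finset.card_fin] at this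
      rw [fullRows]; omega
    have h1 : ∑ r, (N - ρ k r) ≤ (N - fullRows (ρ k)) * (N - shortestRow (ρ k)) := by
      rw [hnot]
      calc _ = ∑ r ∈ Finset.univ.filter (fun r => ¬ ρ k r = N), (N - ρ k r) := by
            rw [Finset.sum_filter]
            refine Finset.sum_congr rfl fun r _ => ?_
            split_ifs <;> omega
        _ ≤ _ := (Finset.sum_le_card_nsmul _ _ _ fun r _ =>
            Nat.sub_le_sub_left (shortestRow_le _ r) N).trans_eq (smul_eq_mul _ _)
    have h2 : ∑ r, ρ k r + ∑ r, (N - ρ k r) = N ^ 2 := by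
      rw [← Finset.sum_add_distrib, Finset.sum_congr rfl fun r _ => Nat.add_sub_cancel' (hle k r)]
      simp [sq]
    rw [hsum k hk] at h2
    omega
  case b_eq =>
    intro k hp
    obtain ⟨r, hr⟩ := Finset.card_pos.mp hp
    refine le_antisymm (longestRow_le (hle k)) ?_
    have := le_longestRow (ρ k) r
    simp only [Finset.mem_filter, Finset.mem_univ, true_and] at hr
    omega
  case a_eq =>
    intro k hq
    rw [nonemptyRows, Finset.filter_true_of_mem fun r _ => hq.trans_le (shortestRow_le _ r)]
    simp
  case R_lt => intro k _; exact rowRank_lt _ _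
  case C_lt => exact hC
  -- If column `c` receives cells at times `k < l`, the rows longer than `c` at time `k` are still
  -- longer at time `l`, and the row extended at time `k` has joined them. So the rank strictly
  -- increases.
  case inj =>
    have key : ∀ k l, k < l → l < N ^ 2 → ρ k (row k) = ρ l (row l) →
        rowRank (ρ k) (row k) < rowRank (ρ l) (row l) := by
      intro k l hkl hl h
      refine rowRank_add_one_le _ ?_ fun s hs => ?_
      · have := hmono (show k + 1 ≤ l from hkl) (row k)
        have := hrow k (by omega)
        simp only [Finset.mem_filter, Finset.mem_univ, true_and]
        omega
      · have := hmono hkl.le s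
        simp only [Finset.mem_filter, Finset.mem_univ, true_and]
        omega
    intro k l hk hl hR hCC
    rcases lt_trichotomy k l with h | h | h
    · exact absurd hR (key k l h hl hCC).ne
    · exact h
    · exact absurd hR.symm (key l k h hk hCC.symm).ne
  case R_lt_a =>
    intro k hk
    refine rowRank_add_one_le _ ?_ fun s hs => ?_
    · simp [hrow k hk]
    · simpa using (Nat.zero_le _).trans_lt (hs.trans_le (hmono k.le_succ s))
  case C_lt_b =>
    intro k hk
    have := le_longestRow (ρ (k + 1)) (row k)
    rw [hrow k hk] at this
    exact this
  case p_le_R =>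
    intro k hk
    have := hC k hk
    refine Finset.card_le_card fun r hr => ?_
    simp only [Finset.mem_filter, Finset.mem_univ, true_and] at hr ⊢
    omega
  case q_le_C => intro k _; exact shortestRow_le _ _
  case p_succ_le =>
    intro k hk
    refine le_rowRank_add_one _ fun s hs hne => ?_
    have := hC k hk
    simp only [Finset.mem_filter, Finset.mem_univ, true_and, hother k hk s hne] at hs
    omega
  case q_succ_le =>
    intro k hk
    have := shortestRow_le (ρ (k + 1)) (row k)
    rwa [hrow k hk] at this
  case p_succ_le_of_lt =>
    intro k hk hlt
    refine Finset.card_le_card fun s hs => ?_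
    by_cases h : s = row k
    · subst h
      simp only [Finset.mem_filter, Finset.mem_univ, true_and, hrow k hk] at hs
      omega
    · simp only [Finset.mem_filter, Finset.mem_univ, true_and, hother k hk s h] at hs ⊢
      omega
  -- Were the minimum to exceed `C k`, all other rows would already be longer, and the new cell
  -- would lie in the last row of the diagram.
  case q_succ_le_of_lt =>
    intro k hk hlt
    by_contra! hq
    have := le_rowRank_add_one (σ := ρ k) (r := row k) Finset.univ fun s _ hne => by
      have := shortestRow_le (ρ (k + 1)) s
      rw [hother k hk s hne] at this
      omega
    rw [Finset.card_fin] at this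
    omega
  case q_pos =>
    intro k hk hR
    refine le_shortestRow (m := 1) fun s => ?_
    by_cases h : s = row k
    · rw [h, hrow k hk]; omega
    · rw [hother k hk s h]
      by_contra! hlt
      have : rowRank (ρ k) (row k) + 1 ≤ (Finset.univ.erase s).card := by
        refine rowRank_add_one_le _ (by simp [Ne.symm h]) fun t ht => ?_
        simp only [Finset.mem_erase, Finset.mem_univ, and_true]
        rintro rfl
        omega
      simp at this
      omega
  case p_pos =>
    intro k hk hCN
    refine Finset.card_pos.mpr ⟨row k, ?_⟩
    simp [hrow k hk, hCN]

/-! ### The edgesum is at least a sum of sizes of edge boundaries -/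

/-- The distance is the number of thresholds `k` that separate the two labels. -/
theorem abs_sub_eq_sum_ite {x y n : ℕ} (hx : x < n) (hy : y < n) :
    |(x : ℤ) - y| = ∑ k ∈ Finset.Icc 1 (n - 1), if (x < k ↔ y < k) then 0 else 1 := by
  wlog h : x ≤ y generalizing x y
  · rw [abs_sub_comm, this hy hx (le_of_not_ge h)]
    simp_rw [iff_comm]
  rw [Finset.sum_ite, Finset.sum_const_zero, zero_add, Finset.sum_const, nsmul_one,
    show (Finset.Icc 1 (n - 1)).filter (fun k => ¬ (x < k ↔ y < k)) = Finset.Ioc x y by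
      ext k; simp only [Finset.mem_filter, Finset.mem_Icc, Finset.mem_Ioc]; omega,
    Nat.card_Ioc, abs_sub_comm, abs_of_nonneg (by omega)]
  omega

/-- A path with labels on both sides of a threshold has an edge crossing it. -/
theorem sum_abs_sub_ge {M n : ℕ} (g : Fin (M + 1) → ℕ) (hg : ∀ i, g i < n) :
    ∑ k ∈ Finset.Icc 1 (n - 1), (if (∃ i, g i < k) ∧ ∃ i, k ≤ g i then (1 : ℤ) else 0) ≤
      ∑ i : Fin M, |(g i.castSucc : ℤ) - g i.succ| := by
  classical
  simp_rw [abs_sub_eq_sum_ite (hg _) (hg _)]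
  rw [Finset.sum_comm]
  refine Finset.sum_le_sum fun k _ => ?_
  have h0 : ∀ i ∈ (Finset.univ : Finset (Fin M)),
      (0 : ℤ) ≤ if (g i.castSucc < k ↔ g i.succ < k) then 0 else 1 := by
    intro i _; split_ifs <;> norm_num
  split_ifs with h
  · obtain ⟨⟨i, hi⟩, j, hj⟩ := h
    obtain ⟨l, hl⟩ : ∃ l : Fin M, ¬ (g l.castSucc < k ↔ g l.succ < k) := by
      by_contra! hall
      have hconst : ∀ l, g l < k ↔ g 0 < k := fun l => by
        induction l using Fin.induction with
        | zero => rfl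
        | succ l ih => rw [← hall l, ih]
      have := (hconst i).mp hi
      have := (hconst j).mpr this
      omega
    refine le_trans ?_ (Finset.single_le_sum h0 (Finset.mem_univ l))
    rw [if_neg hl]
  · exact Finset.sum_nonneg h0

/-! ### Lattice edges split into row and column paths, and the row counts of an enumeration. -/

theorem sum_squareLattice_edgeFinset {M : ℕ} (φ : Sym2 (Fin (M + 1) × Fin (M + 1)) → ℤ) :
    ∑ e ∈ (squareLattice (M + 1)).edgeFinset, φ e =
      ∑ r : Fin (M + 1), ∑ c : Fin M, φ s((r, c.castSucc), (r, c.succ)) +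
        ∑ c : Fin (M + 1), ∑ r : Fin M, φ s((r.castSucc, c), (r.succ, c)) := by
  classical
  let Φ : (Fin (M + 1) × Fin M) ⊕ (Fin (M + 1) × Fin M) → Sym2 (Fin (M + 1) × Fin (M + 1)) :=
    Sum.elim (fun z => s((z.1, z.2.castSucc), (z.1, z.2.succ)))
      (fun z => s((z.2.castSucc, z.1), (z.2.succ, z.1)))
  have hinj : Function.Injective Φ := by
    rintro (⟨r, c⟩ | ⟨c, r⟩) (⟨r', c'⟩ | ⟨c', r'⟩) h <;>
      simp only [Φ, Sum.elim_inl, Sum.elim_inr, Sym2.eq_iff, Prod.mk.injEq, Fin.ext_iff,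
        Fin.val_castSucc, Fin.val_succ] at h <;>
      simp only [Sum.inl.injEq, Sum.inr.injEq, Prod.mk.injEq, Fin.ext_iff, reduceCtorEq] <;> omega
  have himg : (squareLattice (M + 1)).edgeFinset = Finset.univ.image Φ := by
    ext e
    induction e with | _ u v
    obtain ⟨r, c⟩ := u
    obtain ⟨r', c'⟩ := v
    simp only [SimpleGraph.mem_edgeFinset, SimpleGraph.mem_edgeSet, SimpleGraph.boxProd_adj,
      SimpleGraph.pathGraph_adj, Finset.mem_image, Finset.mem_univ, true_and, Sum.exists,
      Prod.exists, Φ, Sum.elim_inl, Sum.elim_inr, Sym2.eq_iff, Prod.mk.injEq, Fin.ext_iff,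
      Fin.val_castSucc, Fin.val_succ]
    constructor
    · rintro (⟨h | h, h'⟩ | ⟨h | h, h'⟩)
      · exact Or.inr ⟨c, ⟨r, by omega⟩, by dsimp only; omega⟩
      · exact Or.inr ⟨c, ⟨r', by omega⟩, by dsimp only; omega⟩
      · exact Or.inl ⟨r, ⟨c, by omega⟩, by dsimp only; omega⟩
      · exact Or.inl ⟨r, ⟨c', by omega⟩, by dsimp only; omega⟩
    · rintro (⟨i, j, h⟩ | ⟨i, j, h⟩) <;> omega
  rw [himg, Finset.sum_image hinj.injOn, Fintype.sum_sum_type, Fintype.sum_prod_type,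
    Fintype.sum_prod_type]
  rfl

/-- The number of cells of the row `r` with labels less than `k`. -/
def rowCount {N n : ℕ} (f : Fin N × Fin N ≃ Fin n) (k : ℕ) (r : Fin N) : ℕ :=
  (Finset.univ.filter fun c => (f (r, c) : ℕ) < k).card

theorem diagramGrowth_rowCount {N : ℕ} [NeZero N] (f : Fin N × Fin N ≃ Fin (N ^ 2)) :
    ∃ R C : ℕ → ℕ, DiagramGrowth N (fun k => nonemptyRows (rowCount f k))
      (fun k => longestRow (rowCount f k)) (fun k => fullRows (rowCount f k))
      (fun k => shortestRow (rowCount f k)) R C := by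
  let row : ℕ → Fin N := fun k => if h : k < N ^ 2 then (f.symm ⟨k, h⟩).1 else 0
  refine ⟨_, _, diagramGrowth_of_rowCounts (row := row) ?_ ?_ ?_ ?_ ?_⟩
  · intro k l hkl r
    refine Finset.card_le_card fun c hc => ?_
    simp only [Finset.mem_filter, Finset.mem_univ, true_and] at hc ⊢
    omega
  · intro k r
    exact (Finset.card_le_univ _).trans (by simp)
  · intro k hk
    calc ∑ r, rowCount f k r = ∑ z : Fin N × Fin N, if (f z : ℕ) < k then 1 else 0 := by
          rw [Fintype.sum_prod_type]
          exact Finset.sum_congr rfl fun r _ => by rw [rowCount, Finset.card_filter]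
      _ = ∑ i : Fin (N ^ 2), if (i : ℕ) < k then 1 else 0 :=
          f.sum_comp fun i => if (i : ℕ) < k then 1 else 0
      _ = k := by
          rw [Fin.sum_univ_eq_sum_range fun i => if i < k then 1 else 0, ← Finset.sum_filter,
            show (Finset.range (N ^ 2)).filter (· < k) = Finset.range k by ext i; simp; omega]
          simp
  · intro k hk
    have hcell : f (row k, (f.symm ⟨k, hk⟩).2) = ⟨k, hk⟩ := by
      simp [row, hk]
    rw [rowCount, rowCount,
      ← Finset.card_insert_of_notMem (a := (f.symm ⟨k, hk⟩).2) (by simp [hcell])]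
    congr 1
    ext c
    have : c = (f.symm ⟨k, hk⟩).2 ↔ (f (row k, c) : ℕ) = k := by
      constructor
      · rintro rfl; rw [hcell]
      · intro h
        have h' : f (row k, c) = f (row k, (f.symm ⟨k, hk⟩).2) := by
          rw [hcell]; exact Fin.ext h
        simpa using f.injective h'
    simp only [Finset.mem_filter, Finset.mem_univ, true_and, Finset.mem_insert, this]
    omega
  · intro k hk r hr
    rw [rowCount, rowCount]
    congr 1
    ext c
    have : (f (r, c) : ℕ) ≠ k := by
      intro h
      apply hr
      have h' : (r, c) = f.symm ⟨k, hk⟩ := by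
        rw [Equiv.eq_symm_apply]; exact Fin.ext h
      simp [row, hk, ← h']
    simp only [Finset.mem_filter, Finset.mem_univ, true_and]
    omega

theorem ite_sub_ite_le {A B D : Prop} [Decidable A] [Decidable B] [Decidable (A ∧ D)]
    (h : ¬ B → D) :
    (if A then (1 : ℤ) else 0) - (if B then 1 else 0) ≤ if A ∧ D then 1 else 0 := by
  split_ifs <;> tauto

/-- At threshold `k`, every row or column with labels on both sides contributes a cut edge. Mixed
rows are exactly the nonempty rows that are not full; for columns, only row lengths are used. -/
theorem edgesum_ge {M : ℕ} (f : Fin (M + 1) × Fin (M + 1) ≃ Fin ((M + 1) ^ 2)) :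
    ∑ k ∈ Finset.Icc 1 ((M + 1) ^ 2 - 1), ((nonemptyRows (rowCount f k) : ℤ) +
      longestRow (rowCount f k) - fullRows (rowCount f k) - shortestRow (rowCount f k)) ≤
      edgesum (squareLattice (M + 1)) f := by
  classical
  rw [edgesum, sum_squareLattice_edgeFinset]
  refine le_trans ?_ (add_le_add
    (Finset.sum_le_sum fun r _ => sum_abs_sub_ge (fun c => (f (r, c) : ℕ)) fun c => (f (r, c)).isLt)
    (Finset.sum_le_sum fun c _ => sum_abs_sub_ge (fun r => (f (r, c) : ℕ)) fun r => (f (r, c)).isLt))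
  rw [Finset.sum_comm, Finset.sum_comm (s := Finset.univ) (t := Finset.Icc 1 ((M + 1) ^ 2 - 1)),
    ← Finset.sum_add_distrib]
  refine Finset.sum_le_sum fun k _ => ?_
  set σ := rowCount f k with hσ
  have hmem : ∀ r, 0 < σ r ↔ ∃ c, (f (r, c) : ℕ) < k := fun r => by
    simp [σ, rowCount, Finset.card_pos, Finset.filter_nonempty_iff]
  have hfull : ∀ r, σ r = M + 1 ↔ ∀ c, (f (r, c) : ℕ) < k := fun r => by
    have := Finset.card_filter_eq_iff (s := (Finset.univ : Finset (Fin (M + 1))))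
      (p := fun c => (f (r, c) : ℕ) < k)
    rw [Finset.card_fin] at this
    simpa [hσ, rowCount] using this
  have hrows : (nonemptyRows σ : ℤ) - fullRows σ ≤
      ∑ r, if (∃ c, (f (r, c) : ℕ) < k) ∧ ∃ c, k ≤ (f (r, c) : ℕ) then (1 : ℤ) else 0 := by
    simp_rw [nonemptyRows, fullRows, Finset.card_filter, Nat.cast_sum, ← Finset.sum_sub_distrib,
      hmem, hfull, Nat.cast_ite, Nat.cast_one, Nat.cast_zero]
    exact Finset.sum_le_sum fun r _ => ite_sub_ite_le fun h => by simpa using h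
  -- The longest row meets that many distinct columns, and every full column meets the shortest row.
  -- Sorting rows thus never increases the number of mixed columns counted.
  have hcols : (longestRow σ : ℤ) - shortestRow σ ≤
      ∑ c, if (∃ r, (f (r, c) : ℕ) < k) ∧ ∃ r, k ≤ (f (r, c) : ℕ) then (1 : ℤ) else 0 := by
    have h1 : longestRow σ ≤ ∑ c, if ∃ r, (f (r, c) : ℕ) < k then 1 else 0 := by
      rw [← Finset.card_filter]
      refine longestRow_le fun r => Finset.card_le_card fun c hc => ?_
      simp only [Finset.mem_filter, Finset.mem_univ, true_and] at hc ⊢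
      exact ⟨r, hc⟩
    have h2 : ∑ c, (if ∀ r, (f (r, c) : ℕ) < k then 1 else 0) ≤ shortestRow σ := by
      rw [← Finset.card_filter]
      refine le_shortestRow fun r => Finset.card_le_card fun c hc => ?_
      simp only [Finset.mem_filter, Finset.mem_univ, true_and] at hc ⊢
      exact hc r
    refine (sub_le_sub (Int.ofNat_le.mpr h1) (Int.ofNat_le.mpr h2)).trans ?_
    simp_rw [Nat.cast_sum, Nat.cast_ite, Nat.cast_one, Nat.cast_zero, ← Finset.sum_sub_distrib]
    exact Finset.sum_le_sum fun c _ => ite_sub_ite_le fun h => by simpa using h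
  linarith

/-- The bound from `exists_sum_ge` separates into half of `sideCost` at each of the two crossing
parameters, so each half can be minimised alone; parameters above `N / 2` are first reflected. -/
theorem edgesum_ge_sideCost {N x : ℕ} (hN : 2 ≤ N) (hx : 2 * x ≤ N)
    (h1 : (2 * (N : ℤ) - 1 - 2 * x) ^ 2 ≤ 2 * (N : ℤ) ^ 2 - 2 * N + 1)
    (h2 : 2 * (N : ℤ) ^ 2 - 2 * N + 1 ≤ (2 * (N : ℤ) + 1 - 2 * x) ^ 2)
    (f : Fin N × Fin N ≃ Fin (N ^ 2)) :
    (N : ℤ) * ((N : ℤ) ^ 2 - 1) + sideCost N x ≤ edgesum (squareLattice N) f := by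
  obtain ⟨M, rfl⟩ : ∃ M, N = M + 1 := ⟨N - 1, by omega⟩
  obtain ⟨R, C, hg⟩ := diagramGrowth_rowCount f
  obtain ⟨y, z, hy1, hyN, hz1, hzN, hle⟩ := hg.exists_sum_ge hN
  have hmin : ∀ y, 1 ≤ y → y + 1 ≤ M + 1 → sideCost (M + 1) x ≤ sideCost (M + 1) y := by
    intro y hy hyN
    rcases le_total (2 * y) (M + 1) with h | h
    · exact sideCost_min hx h h1 h2
    · exact (sideCost_min hx (by omega) h1 h2).trans (sideCost_le_of_le h hyN)
  refine le_trans ?_ (hle.trans (edgesum_ge f))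
  have hy := hmin y hy1 hyN
  have hz := hmin z hz1 hzN
  rw [sideCost] at hy hz ⊢
  rw [sideCost] at hy hz
  linarith

/-! ### The Mitchison–Durbin pattern -/

/-- Triangular numbers. -/
def tri (n : ℕ) : ℕ := n * (n - 1) / 2

theorem tri_succ (n : ℕ) : tri (n + 1) = tri n + n := Nat.triangle_succ n

theorem tri_mono : Monotone tri :=
  monotone_nat_of_le_succ fun n => by rw [tri_succ]; omega

theorem two_mul_tri (n : ℕ) : 2 * (tri n : ℤ) = n * (n - 1) := by
  induction n with
  | zero => rfl
  | succ n ih =>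
    rw [tri_succ]
    push_cast
    linarith

theorem tri_add_tri (n : ℕ) : tri (n + 1) + tri n = n * n := by
  have h1 := two_mul_tri (n + 1)
  have h2 := two_mul_tri n
  zify
  push_cast at h1
  linarith

/-- Recovers the index of a layer from a label, since the half-open blocks `[b s, b (s + 1))` are
disjoint. -/
theorem eq_of_mem_block {b : ℕ → ℕ} (hb : Monotone b) {s t v : ℕ} (h1 : b s ≤ v)
    (h2 : v < b (s + 1)) (h3 : b t ≤ v) (h4 : v < b (t + 1)) : s = t := by
  by_contra hne
  rcases Nat.lt_or_gt_of_ne hne with h | h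
  · have := hb (show s + 1 ≤ t from h); omega
  · have := hb (show t + 1 ≤ s from h); omega

section MitchisonDurbin

variable {N x r c : ℕ}

theorem mdLeft_top_row (hr : r < x) (hc : c < r) : mdLeft N x r c = r ^ 2 + c := by
  rw [mdLeft, if_pos hr, if_pos hc]

theorem mdLeft_top_col (hr : r < x) (hc : r ≤ c) : mdLeft N x r c = c * (c + 1) + r := by
  rw [mdLeft, if_pos hr, if_neg (by omega)]

theorem mdLeft_middle (hr : x ≤ r) (hr' : r < N - x) : mdLeft N x r c = r * x + c := by
  rw [mdLeft, if_neg (by omega), if_pos hr']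

theorem mdLeft_bottom_row (hxN : 2 * x ≤ N) (hr : N - x ≤ r) (hc : c < N - r) :
    mdLeft N x r c = x * (N - x) + (tri (x + 1) - tri (N - r + 1)) + c := by
  rw [mdLeft, if_neg (by omega), if_neg (by omega), if_pos hc, tri, tri, Nat.add_sub_cancel,
    Nat.add_sub_cancel, mul_comm (x + 1), mul_comm (N - r + 1)]

theorem mdLeft_bottom_col (hxN : 2 * x ≤ N) (hr : N - x ≤ r) (hc : N - r ≤ c) :
    mdLeft N x r c = x * (N - x) + tri (x + 1) + tri c + (r + c - N) := by
  rw [mdLeft, if_neg (by omega), if_neg (by omega), if_neg (by omega), tri, tri,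
    Nat.add_sub_cancel, mul_comm (x + 1)]

theorem mul_sub_add_tri (hxN : 2 * x ≤ N) :
    x * (N - x) + tri (x + 1) + tri x = x * N := by
  rw [add_assoc, tri_add_tri, ← mul_add, Nat.sub_add_cancel (by omega)]

/-- In the top left square, the labels in row and column `s`, inside the square of side `s + 1`,
are those from `s ^ 2` to `(s + 1) ^ 2 - 1`. -/
theorem mdLeft_top_mem (hr : r < x) :
    max r c ^ 2 ≤ mdLeft N x r c ∧ mdLeft N x r c < (max r c + 1) ^ 2 := by
  rcases lt_or_ge c r with h | h
  · rw [mdLeft_top_row hr h, max_eq_left h.le]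
    constructor <;> nlinarith
  · rw [mdLeft_top_col hr h, max_eq_right h]
    constructor <;> nlinarith

theorem mdLeft_top_lt (hr : r < x) (hc : c < x) : mdLeft N x r c < x * x := by
  refine (mdLeft_top_mem hr).2.trans_le ?_
  rw [← sq]
  exact Nat.pow_le_pow_left (by omega) 2

theorem mdLeft_middle_mem (hr : x ≤ r) (hr' : r < N - x) (hc : c < x) :
    x * x ≤ mdLeft N x r c ∧ mdLeft N x r c < x * (N - x) := by
  rw [mdLeft_middle hr hr']
  constructor
  · nlinarith
  · have := Nat.mul_le_mul_left x (show r + 1 ≤ N - x by omega)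
    nlinarith

theorem mdLeft_bottom_row_mem (hxN : 2 * x ≤ N) (hr : N - x ≤ r) (hc : c < N - r) :
    x * (N - x) ≤ mdLeft N x r c ∧ mdLeft N x r c < x * (N - x) + tri (x + 1) := by
  rw [mdLeft_bottom_row hxN hr hc]
  have h1 := tri_succ (N - r)
  have h2 := tri_mono (show N - r + 1 ≤ x + 1 by omega)
  omega

theorem mdLeft_bottom_col_mem (hxN : 2 * x ≤ N) (hr : N - x ≤ r) (hrN : r < N) (hc : N - r ≤ c)
    (hcx : c < x) :
    x * (N - x) + tri (x + 1) ≤ mdLeft N x r c ∧ mdLeft N x r c < x * N := by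
  rw [mdLeft_bottom_col hxN hr hc, ← mul_sub_add_tri hxN]
  have h1 := tri_succ c
  have h2 := tri_mono (show c + 1 ≤ x from hcx)
  omega

theorem mdLeft_lt (hxN : 2 * x ≤ N) (hr : r < N) (hc : c < x) : mdLeft N x r c < x * N := by
  have h1 := mul_sub_add_tri hxN
  have h2 : x * x ≤ x * (N - x) := Nat.mul_le_mul_left x (by omega)
  rcases lt_or_ge r x with hrx | hrx
  · have := mdLeft_top_lt (N := N) hrx hc
    omega
  rcases lt_or_ge r (N - x) with hrx' | hrx'
  · have := mdLeft_middle_mem hrx hrx' hc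
    omega
  rcases lt_or_ge c (N - r) with hcr | hcr
  · have := mdLeft_bottom_row_mem hxN hrx' hcr
    omega
  · exact (mdLeft_bottom_col_mem hxN hrx' hr hcr hc).2

/-- The four regions occupy disjoint label intervals. Within a region, labels come in blocks
(shells, rows or columns), so the block is identified first and the position in it second. -/
theorem mdLeft_injective (hxN : 2 * x ≤ N) {r' c' : ℕ} (hr : r < N) (hr' : r' < N) (hc : c < x)
    (hc' : c' < x) (h : mdLeft N x r c = mdLeft N x r' c') : r = r' ∧ c = c' := by
  have regions : ∀ {r c : ℕ}, r < N → c < x →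
      (r < x ∧ mdLeft N x r c < x * x) ∨
      (x ≤ r ∧ r < N - x ∧ x * x ≤ mdLeft N x r c ∧ mdLeft N x r c < x * (N - x)) ∨
      (N - x ≤ r ∧ c < N - r ∧ x * (N - x) ≤ mdLeft N x r c ∧
        mdLeft N x r c < x * (N - x) + tri (x + 1)) ∨
      (N - x ≤ r ∧ N - r ≤ c ∧ x * (N - x) + tri (x + 1) ≤ mdLeft N x r c) := by
    intro r c hr hc
    rcases lt_or_ge r x with hrx | hrx
    · exact Or.inl ⟨hrx, mdLeft_top_lt hrx hc⟩
    rcases lt_or_ge r (N - x) with hrx' | hrx'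
    · exact Or.inr (Or.inl ⟨hrx, hrx', mdLeft_middle_mem hrx hrx' hc⟩)
    rcases lt_or_ge c (N - r) with hcr | hcr
    · exact Or.inr (Or.inr (Or.inl ⟨hrx', hcr, mdLeft_bottom_row_mem hxN hrx' hcr⟩))
    · exact Or.inr (Or.inr (Or.inr ⟨hrx', hcr, (mdLeft_bottom_col_mem hxN hrx' hr hcr hc).1⟩))
  have hxx : x * x ≤ x * (N - x) := Nat.mul_le_mul_left x (by omega)
  rcases regions hr hc with ⟨a1, a2⟩ | ⟨a1, a2, a3, a4⟩ | ⟨a1, a2, a3, a4⟩ | ⟨a1, a2, a3⟩ <;>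
  rcases regions hr' hc' with ⟨b1, b2⟩ | ⟨b1, b2, b3, b4⟩ | ⟨b1, b2, b3, b4⟩ | ⟨b1, b2, b3⟩ <;>
  try omega
  · have h1 := mdLeft_top_mem (N := N) (c := c) a1
    have h2 := mdLeft_top_mem (N := N) (c := c') b1
    rw [← h] at h2
    have hmax := eq_of_mem_block (b := fun s => s ^ 2) (fun _ _ h => Nat.pow_le_pow_left h 2)
      h1.1 h1.2 h2.1 h2.2
    rcases lt_or_ge c r with hcr | hcr <;> rcases lt_or_ge c' r' with hcr' | hcr'
    · rw [max_eq_left hcr.le, max_eq_left hcr'.le] at hmax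
      rw [mdLeft_top_row a1 hcr, mdLeft_top_row b1 hcr', hmax] at h
      omega
    · rw [max_eq_left hcr.le, max_eq_right hcr'] at hmax
      rw [mdLeft_top_row a1 hcr, mdLeft_top_col b1 hcr', hmax] at h
      nlinarith
    · rw [max_eq_right hcr, max_eq_left hcr'.le] at hmax
      rw [mdLeft_top_col a1 hcr, mdLeft_top_row b1 hcr', hmax] at h
      nlinarith
    · rw [max_eq_right hcr, max_eq_right hcr'] at hmax
      rw [mdLeft_top_col a1 hcr, mdLeft_top_col b1 hcr', hmax] at h
      omega
  · rw [mdLeft_middle a1 a2, mdLeft_middle b1 b2] at h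
    have hrr : r = r' := eq_of_mem_block (b := fun s => s * x)
      (fun _ _ h => Nat.mul_le_mul_right x h) (v := r * x + c) (by omega)
      (by rw [Nat.succ_mul]; omega) (by omega)
      (by rw [Nat.succ_mul]; omega)
    subst hrr
    omega
  · rw [mdLeft_bottom_row hxN a1 a2, mdLeft_bottom_row hxN b1 b2] at h
    have e1 := tri_succ (N - r)
    have e2 := tri_mono (show N - r + 1 ≤ x + 1 by omega)
    have e3 := tri_succ (N - r')
    have e4 := tri_mono (show N - r' + 1 ≤ x + 1 by omega)
    -- These rows shorten as labels increase, so the labels are counted backwards from the end of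
    -- the region to obtain increasing triangular blocks.
    have hrr : N - r = N - r' := eq_of_mem_block tri_mono (v := tri (N - r + 1) - 1 - c)
      (by omega) (by omega) (by omega) (by omega)
    rw [hrr] at h
    omega
  · rw [mdLeft_bottom_col hxN a1 a2, mdLeft_bottom_col hxN b1 b2] at h
    have e1 := tri_succ c
    have e2 := tri_succ c'
    have hcc : c = c' := eq_of_mem_block tri_mono (v := tri c + (r + c - N))
      (by omega) (by omega) (by omega) (by omega)
    subst hcc
    omega

/-! ### Labels of the whole square: left, middle and right column blocks. -/

theorem mdLabel_left (hc : c < x) : mdLabel N x r c = mdLeft N x r c := if_pos hc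

theorem mdLabel_middle (hc : x ≤ c) (hc' : c < N - x) : mdLabel N x r c = c * N + r := by
  rw [mdLabel, if_neg (by omega), if_pos hc']

theorem mdLabel_right (hxN : 2 * x ≤ N) (hc : N - x ≤ c) :
    mdLabel N x r c = N ^ 2 - 1 - mdLeft N x (N - 1 - r) (N - 1 - c) := by
  rw [mdLabel, if_neg (by omega), if_neg (by omega)]

theorem mdLabel_middle_mem (hr : r < N) (hc : x ≤ c) (hc' : c < N - x) :
    x * N ≤ mdLabel N x r c ∧ mdLabel N x r c < (N - x) * N := by
  rw [mdLabel_middle hc hc']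
  have h1 := Nat.mul_le_mul_right N hc
  have h2 := Nat.mul_le_mul_right N (show c + 1 ≤ N - x from hc')
  rw [Nat.succ_mul] at h2
  omega

theorem mdLabel_right_mem (hxN : 2 * x ≤ N) (hr : r < N) (hc : N - x ≤ c) (hcN : c < N) :
    (N - x) * N ≤ mdLabel N x r c ∧ mdLabel N x r c < N ^ 2 := by
  rw [mdLabel_right hxN hc]
  have h1 := mdLeft_lt hxN (show N - 1 - r < N by omega) (show N - 1 - c < x by omega)
  have h2 : (N - x) * N + x * N = N ^ 2 := by
    rw [← add_mul, Nat.sub_add_cancel (by omega), sq]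
  omega

theorem mul_add_sub_mul_sq (hxN : 2 * x ≤ N) :
    x * N ≤ (N - x) * N ∧ (N - x) * N + x * N = N ^ 2 := by
  refine ⟨Nat.mul_le_mul_right N (by omega), ?_⟩
  rw [← add_mul, Nat.sub_add_cancel (by omega), sq]

theorem mdLabel_lt (hxN : 2 * x ≤ N) (hr : r < N) (hc : c < N) : mdLabel N x r c < N ^ 2 := by
  have h := mul_add_sub_mul_sq hxN
  rcases lt_or_ge c x with h1 | h1
  · have := mdLeft_lt hxN hr h1
    rw [mdLabel_left h1]
    omega
  rcases lt_or_ge c (N - x) with h2 | h2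
  · have := mdLabel_middle_mem hr h1 h2
    omega
  · exact (mdLabel_right_mem hxN hr h2 hc).2

theorem mdLabel_injective (hxN : 2 * x ≤ N) {r' c' : ℕ} (hr : r < N) (hr' : r' < N) (hc : c < N)
    (hc' : c' < N) (h : mdLabel N x r c = mdLabel N x r' c') : r = r' ∧ c = c' := by
  have hsq := mul_add_sub_mul_sq hxN
  have regions : ∀ {r c : ℕ}, r < N → c < N →
      (c < x ∧ mdLabel N x r c < x * N) ∨
      (x ≤ c ∧ c < N - x ∧ x * N ≤ mdLabel N x r c ∧ mdLabel N x r c < (N - x) * N) ∨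
      (N - x ≤ c ∧ (N - x) * N ≤ mdLabel N x r c) := by
    intro r c hr hc
    rcases lt_or_ge c x with h1 | h1
    · exact Or.inl ⟨h1, by rw [mdLabel_left h1]; exact mdLeft_lt hxN hr h1⟩
    rcases lt_or_ge c (N - x) with h2 | h2
    · exact Or.inr (Or.inl ⟨h1, h2, mdLabel_middle_mem hr h1 h2⟩)
    · exact Or.inr (Or.inr ⟨h2, (mdLabel_right_mem hxN hr h2 hc).1⟩)
  rcases regions hr hc with ⟨a1, a2⟩ | ⟨a1, a2, a3, a4⟩ | ⟨a1, a2⟩ <;>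
  rcases regions hr' hc' with ⟨b1, b2⟩ | ⟨b1, b2, b3, b4⟩ | ⟨b1, b2⟩ <;>
  try omega
  · rw [mdLabel_left a1, mdLabel_left b1] at h
    exact mdLeft_injective hxN hr hr' a1 b1 h
  · rw [mdLabel_middle a1 a2, mdLabel_middle b1 b2] at h
    have hcc : c = c' := eq_of_mem_block (b := fun s => s * N)
      (fun _ _ h => Nat.mul_le_mul_right N h) (v := c * N + r) (by omega)
      (by rw [Nat.succ_mul]; omega) (by omega)
      (by rw [Nat.succ_mul]; omega)
    subst hcc
    omega
  · rw [mdLabel_right hxN a1, mdLabel_right hxN b1] at h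
    have h1 := mdLeft_lt hxN (show N - 1 - r < N by omega) (show N - 1 - c < x by omega)
    have h2 := mdLeft_lt hxN (show N - 1 - r' < N by omega) (show N - 1 - c' < x by omega)
    have := mdLeft_injective hxN (show N - 1 - r < N by omega) (show N - 1 - r' < N by omega)
      (show N - 1 - c < x by omega) (show N - 1 - c' < x by omega) (by omega)
    omega

theorem exists_equiv_mdLabel (hxN : 2 * x ≤ N) :
    ∃ f : Fin N × Fin N ≃ Fin (N ^ 2), ∀ r c : Fin N, (f (r, c) : ℕ) = mdLabel N x r c := by
  let g : Fin N × Fin N → Fin (N ^ 2) :=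
    fun z => ⟨mdLabel N x z.1 z.2, mdLabel_lt hxN z.1.isLt z.2.isLt⟩
  have hg : Function.Bijective g := by
    rw [Fintype.bijective_iff_injective_and_card]
    refine ⟨fun z w h => ?_, by simp [sq]⟩
    have := mdLabel_injective hxN z.1.isLt w.1.isLt z.2.isLt w.2.isLt (Fin.ext_iff.mp h)
    exact Prod.ext (Fin.ext this.1) (Fin.ext this.2)
  exact ⟨Equiv.ofBijective g hg, fun r c => rfl⟩

/-- Monotonicity along rows and columns is what makes the edgesum of the pattern telescope. -/
theorem mdLeft_le_succ_col (hxN : 2 * x ≤ N) (hr : r < N) (hc : c + 1 < x) :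
    mdLeft N x r c ≤ mdLeft N x r (c + 1) := by
  rcases lt_or_ge r x with hrx | hrx
  · rcases lt_trichotomy (c + 1) r with h | h | h
    · rw [mdLeft_top_row hrx (by omega), mdLeft_top_row hrx h]; omega
    · rw [mdLeft_top_row hrx (by omega), mdLeft_top_col hrx (by omega), ← h]; nlinarith
    · rw [mdLeft_top_col hrx (by omega), mdLeft_top_col hrx (by omega)]; nlinarith
  rcases lt_or_ge r (N - x) with hrx' | hrx'
  · rw [mdLeft_middle hrx hrx', mdLeft_middle hrx hrx']; omega
  rcases lt_or_ge c (N - r) with h | h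
  · rcases lt_or_ge (c + 1) (N - r) with h' | h'
    · rw [mdLeft_bottom_row hxN hrx' h, mdLeft_bottom_row hxN hrx' h']; omega
    · have := mdLeft_bottom_row_mem hxN hrx' h
      have := mdLeft_bottom_col_mem hxN hrx' hr h' hc
      omega
  · rw [mdLeft_bottom_col hxN hrx' h, mdLeft_bottom_col hxN hrx' (by omega), tri_succ c]; omega

theorem mdLeft_le_succ_row (hxN : 2 * x ≤ N) (hr : r + 1 < N) (hc : c < x) :
    mdLeft N x r c ≤ mdLeft N x (r + 1) c := by
  have hxx : x * x ≤ x * (N - x) := Nat.mul_le_mul_left x (by omega)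
  rcases lt_or_ge (r + 1) x with hrx | hrx
  · rcases lt_trichotomy c r with h | h | h
    · rw [mdLeft_top_row (by omega) h, mdLeft_top_row hrx (by omega)]; nlinarith
    · rw [mdLeft_top_col (by omega) h.ge, mdLeft_top_row hrx (by omega), h]; nlinarith
    · rw [mdLeft_top_col (by omega) h.le, mdLeft_top_col hrx (by omega)]; omega
  rcases lt_or_ge (r + 1) (N - x) with hrx' | hrx'
  · rcases lt_or_ge r x with h | h
    · have := mdLeft_top_lt (N := N) h hc
      have := mdLeft_middle_mem hrx hrx' hc
      omega
    · rw [mdLeft_middle h (by omega), mdLeft_middle hrx hrx']; nlinarith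
  have hlow : r < N - x → mdLeft N x r c < x * (N - x) := fun hr' => by
    rcases lt_or_ge r x with h | h
    · have := mdLeft_top_lt (N := N) h hc
      omega
    · exact (mdLeft_middle_mem h hr' hc).2
  rcases lt_or_ge c (N - (r + 1)) with h | h
  · rcases lt_or_ge r (N - x) with hr' | hr'
    · have := hlow hr'
      have := mdLeft_bottom_row_mem hxN hrx' h
      omega
    · rw [mdLeft_bottom_row hxN hrx' h, mdLeft_bottom_row hxN hr' (by omega)]
      have := tri_mono (show N - (r + 1) + 1 ≤ N - r + 1 by omega)
      omega
  · have h2 := mdLeft_bottom_col_mem hxN hrx' hr h hc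
    rcases lt_or_ge r (N - x) with hr' | hr'
    · have := hlow hr'
      omega
    · rcases lt_or_ge c (N - r) with h' | h'
      · have := mdLeft_bottom_row_mem hxN hr' h'
        omega
      · rw [mdLeft_bottom_col hxN hrx' h, mdLeft_bottom_col hxN hr' h']; omega

theorem mdLabel_le_succ_col (hxN : 2 * x ≤ N) (hr : r < N) (hc : c + 1 < N) :
    mdLabel N x r c ≤ mdLabel N x r (c + 1) := by
  have hsq := mul_add_sub_mul_sq hxN
  rcases lt_or_ge (c + 1) x with h1 | h1
  · rw [mdLabel_left h1, mdLabel_left (by omega)]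
    exact mdLeft_le_succ_col hxN hr h1
  rcases lt_or_ge c x with h2 | h2
  · have h3 := mdLeft_lt hxN hr h2
    rw [mdLabel_left h2]
    rcases lt_or_ge (c + 1) (N - x) with h4 | h4
    · have := mdLabel_middle_mem hr h1 h4
      omega
    · have := mdLabel_right_mem hxN hr h4 hc
      omega
  rcases lt_or_ge (c + 1) (N - x) with h4 | h4
  · rw [mdLabel_middle h1 h4, mdLabel_middle h2 (by omega)]; nlinarith
  rcases lt_or_ge c (N - x) with h5 | h5
  · have := mdLabel_middle_mem hr h2 h5
    have := mdLabel_right_mem hxN hr h4 hc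
    omega
  · rw [mdLabel_right hxN h4, mdLabel_right hxN h5]
    have := mdLeft_le_succ_col hxN (show N - 1 - r < N by omega)
      (show N - 1 - (c + 1) + 1 < x by omega)
    rw [show N - 1 - (c + 1) + 1 = N - 1 - c by omega] at this
    omega

theorem mdLabel_le_succ_row (hxN : 2 * x ≤ N) (hr : r + 1 < N) (hc : c < N) :
    mdLabel N x r c ≤ mdLabel N x (r + 1) c := by
  rcases lt_or_ge c x with h1 | h1
  · rw [mdLabel_left h1, mdLabel_left h1]
    exact mdLeft_le_succ_row hxN hr h1
  rcases lt_or_ge c (N - x) with h2 | h2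
  · rw [mdLabel_middle h1 h2, mdLabel_middle h1 h2]; omega
  · rw [mdLabel_right hxN h2, mdLabel_right hxN h2]
    have := mdLeft_le_succ_row hxN (show N - 1 - (r + 1) + 1 < N by omega)
      (show N - 1 - c < x by omega)
    rw [show N - 1 - (r + 1) + 1 = N - 1 - r by omega] at this
    omega

end MitchisonDurbin

/-! ### The edgesum of the pattern -/

theorem sum_mdLeft_first_row {N x : ℕ} :
    3 * ∑ c ∈ Finset.range x, (mdLeft N x 0 c : ℤ) = ((x : ℤ) - 1) * x * (x + 1) := by
  have h1 : ∑ c ∈ Finset.range x, (mdLeft N x 0 c : ℤ) =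
      ∑ c ∈ Finset.range x, ((c : ℤ) * (c + 1)) :=
    Finset.sum_congr rfl fun c hc => by
      rw [Finset.mem_range] at hc
      rw [mdLeft_top_col (by omega) (by omega)]
      push_cast; ring
  have h2 : ∀ n : ℕ, 3 * ∑ c ∈ Finset.range n, ((c : ℤ) * (c + 1)) = ((n : ℤ) - 1) * n * (n + 1) := by
    intro n
    induction n with
    | zero => simp
    | succ n ih => rw [Finset.sum_range_succ, mul_add, ih]; push_cast; ring
  rw [h1, h2]

theorem sum_mdLeft_last_row {N x : ℕ} (hx : 1 ≤ x) (hxN : 2 * x ≤ N) :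
    6 * ∑ c ∈ Finset.range x, (mdLeft N x (N - 1) c : ℤ) =
      6 * x * (x * (N - x)) + 3 * x * (x * (x + 1)) - 6 * x + ((x : ℤ) - 1) * x * (x + 1) := by
  have h1 : ∑ c ∈ Finset.range x, (mdLeft N x (N - 1) c : ℤ) =
      ∑ c ∈ Finset.range x, (((x : ℤ) * (N - x) + tri (x + 1) - 1) + tri (c + 1)) :=
    Finset.sum_congr rfl fun c hc => by
      rw [Finset.mem_range] at hc
      have hcast : ((N - x : ℕ) : ℤ) = N - x := by omega
      -- In the last row only the cell in column zero belongs to the part filled row by row.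
      rcases Nat.eq_zero_or_pos c with rfl | hc0
      · rw [mdLeft_bottom_row hxN (by omega) (by omega), show N - (N - 1) = 1 by omega,
          Nat.cast_add, Nat.cast_add, Nat.cast_sub (tri_mono (by omega)), Nat.cast_mul, hcast]
        simp [tri]
        ring
      · rw [mdLeft_bottom_col hxN (by omega) (by omega), show N - 1 + c - N = c - 1 by omega,
          tri_succ c]
        push_cast [hcast, Nat.cast_sub hc0]
        ring
  have h2 : ∀ n : ℕ, 6 * ∑ c ∈ Finset.range n, (tri (c + 1) : ℤ) = ((n : ℤ) - 1) * n * (n + 1) := by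
    intro n
    induction n with
    | zero => simp
    | succ n ih =>
      have := two_mul_tri (n + 1)
      rw [Finset.sum_range_succ, mul_add, ih]; push_cast at this ⊢; linarith
  have h3 := h2 x
  have h4 := two_mul_tri (x + 1)
  rw [h1, Finset.sum_add_distrib, mul_add, h3, Finset.sum_const, Finset.card_range, nsmul_eq_mul]
  push_cast at h4
  linear_combination 3 * (x : ℤ) * h4

theorem sum_mdLeft_first_col {x d : ℕ} (hx : 1 ≤ x) :
    6 * ∑ r ∈ Finset.range (x + d + x), (mdLeft (x + d + x) x r 0 : ℤ) =
      ((x : ℤ) - 1) * x * (2 * x - 1) + 3 * x * (2 * x * d + d * (d - 1)) +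
      6 * x * (x * (x + d)) + 3 * x * (x * (x + 1)) - x * (x + 1) * (x + 2) := by
  have h1 : ∑ r ∈ Finset.range x, (mdLeft (x + d + x) x r 0 : ℤ) =
      ∑ r ∈ Finset.range x, (r : ℤ) ^ 2 :=
    Finset.sum_congr rfl fun r hr => by
      rw [Finset.mem_range] at hr
      rcases Nat.eq_zero_or_pos r with rfl | h0
      · rw [mdLeft_top_col hr le_rfl]; simp
      · rw [mdLeft_top_row hr h0]; simp
  have h2 : ∑ i ∈ Finset.range d, (mdLeft (x + d + x) x (x + i) 0 : ℤ) =
      ∑ i ∈ Finset.range d, ((x : ℤ) + i) * x :=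
    Finset.sum_congr rfl fun i hi => by
      rw [Finset.mem_range] at hi
      rw [mdLeft_middle (by omega) (by omega)]; simp
  have h3 : ∑ i ∈ Finset.range x, (mdLeft (x + d + x) x (x + d + i) 0 : ℤ) =
      ∑ i ∈ Finset.range x, (((x : ℤ) * (x + d) + tri (x + 1)) - tri (i + 2)) := by
    rw [← Finset.sum_range_reflect]
    refine Finset.sum_congr rfl fun i hi => ?_
    rw [Finset.mem_range] at hi
    rw [mdLeft_bottom_row (by omega) (by omega) (by omega), Nat.add_sub_cancel,
      show x + d + x - (x + d + (x - 1 - i)) + 1 = i + 2 by omega, Nat.cast_add, Nat.cast_add,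
      Nat.cast_sub (tri_mono (by omega))]
    push_cast
    ring
  have s1 : ∀ n : ℕ, 6 * ∑ r ∈ Finset.range n, (r : ℤ) ^ 2 = ((n : ℤ) - 1) * n * (2 * n - 1) := by
    intro n
    induction n with
    | zero => simp
    | succ n ih => rw [Finset.sum_range_succ, mul_add, ih]; push_cast; ring
  have s2 : ∀ n : ℕ, 2 * ∑ i ∈ Finset.range n, ((x : ℤ) + i) * x =
      x * (2 * x * n + n * (n - 1)) := by
    intro n
    induction n with
    | zero => simp
    | succ n ih => rw [Finset.sum_range_succ, mul_add, ih]; push_cast; ring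
  have s3 : ∀ n : ℕ, 6 * ∑ i ∈ Finset.range n, (tri (i + 2) : ℤ) = (n : ℤ) * (n + 1) * (n + 2) := by
    intro n
    induction n with
    | zero => simp
    | succ n ih =>
      have := two_mul_tri (n + 2)
      rw [Finset.sum_range_succ, mul_add, ih]; push_cast at this ⊢; linarith
  have h4 := two_mul_tri (x + 1)
  push_cast at h4
  rw [Finset.sum_range_add, Finset.sum_range_add, h1, h2, h3, Finset.sum_sub_distrib,
    Finset.sum_const, Finset.card_range, nsmul_eq_mul]
  linear_combination s1 x + 3 * s2 d - s3 x + 3 * (x : ℤ) * h4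

/-- This identity is the tightness of the lower bound: corner cost and early gain turn into sums of
labels on the boundary of the left block. -/
theorem sideCost_eq_sum_mdLeft {N x : ℕ} (hx : 1 ≤ x) (hxN : 2 * x ≤ N) :
    sideCost N x = 2 * (∑ c ∈ Finset.range x, (mdLeft N x (N - 1) c : ℤ) -
      ∑ c ∈ Finset.range x, (mdLeft N x 0 c : ℤ) - ∑ r ∈ Finset.range N, (mdLeft N x r 0 : ℤ)) +
      ((N : ℤ) - 2 * x) * (N - 1) := by
  have h1 := three_mul_sideCost hxN
  have h2 := sum_mdLeft_first_row (N := N) (x := x)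
  have h3 := sum_mdLeft_last_row hx hxN
  obtain ⟨d, rfl⟩ : ∃ d, N = x + d + x := ⟨N - 2 * x, by omega⟩
  have h4 := sum_mdLeft_first_col (d := d) hx
  push_cast at h1 h3 h4 ⊢
  linarith

theorem sum_abs_sub_of_monotone {M : ℕ} (g : ℕ → ℕ) (hg : ∀ i, i < M → g i ≤ g (i + 1)) :
    ∑ i : Fin M, |(g i : ℤ) - g (i + 1)| = g M - g 0 := by
  rw [Fin.sum_univ_eq_sum_range fun i => |(g i : ℤ) - g (i + 1)|]
  rw [← Finset.sum_range_sub (fun i => (g i : ℤ))]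
  refine Finset.sum_congr rfl fun i hi => ?_
  have := hg i (Finset.mem_range.mp hi)
  rw [abs_sub_comm, abs_of_nonneg (by omega)]

/-- Monotone lines telescope to last label minus first. The half-turn symmetry expresses the right
block through the left one, and each middle column contributes `N - 1`. -/
theorem edgesum_mdLabel {N x : ℕ} (hx : 1 ≤ x) (hxN : 2 * x ≤ N)
    (f : Fin N × Fin N ≃ Fin (N ^ 2)) (hf : ∀ r c : Fin N, (f (r, c) : ℕ) = mdLabel N x r c) :
    edgesum (squareLattice N) f = (N : ℤ) * ((N : ℤ) ^ 2 - 1) + sideCost N x := by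
  obtain ⟨M, rfl⟩ : ∃ M, N = M + 1 := ⟨N - 1, by omega⟩
  have hrow : ∀ r : Fin (M + 1),
      ∑ c : Fin M, labelDiff f s((r, c.castSucc), (r, c.succ)) =
        mdLabel (M + 1) x r M - mdLabel (M + 1) x r 0 := fun r => by
    rw [← sum_abs_sub_of_monotone (fun c => mdLabel (M + 1) x r c) fun c hc =>
      mdLabel_le_succ_col hxN r.isLt (by omega)]
    refine Finset.sum_congr rfl fun c _ => ?_
    simp [labelDiff, hf]
  have hcol : ∀ c : Fin (M + 1),
      ∑ r : Fin M, labelDiff f s((r.castSucc, c), (r.succ, c)) =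
        mdLabel (M + 1) x M c - mdLabel (M + 1) x 0 c := fun c => by
    rw [← sum_abs_sub_of_monotone (fun r => mdLabel (M + 1) x r c) fun r hr =>
      mdLabel_le_succ_row hxN (by omega) c.isLt]
    refine Finset.sum_congr rfl fun r _ => ?_
    simp [labelDiff, hf]
  rw [edgesum, sum_squareLattice_edgeFinset, Finset.sum_congr rfl fun r _ => hrow r,
    Finset.sum_congr rfl fun c _ => hcol c,
    Fin.sum_univ_eq_sum_range fun r => (mdLabel (M + 1) x r M : ℤ) - mdLabel (M + 1) x r 0,
    Fin.sum_univ_eq_sum_range fun c => (mdLabel (M + 1) x M c : ℤ) - mdLabel (M + 1) x 0 c,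
    sideCost_eq_sum_mdLeft hx hxN]
  have hM : M + 1 - 1 = M := rfl
  have hsq : x * (M + 1) ≤ (M + 1) ^ 2 := by rw [sq]; exact Nat.mul_le_mul_right _ (by omega)
  have hmirror : ∀ r c, M + 1 - x ≤ c → c ≤ M → r ≤ M → (mdLabel (M + 1) x r c : ℤ) =
      ((M + 1 : ℕ) : ℤ) ^ 2 - 1 - mdLeft (M + 1) x (M - r) (M - c) := by
    intro r c hc hcM hr
    have := mdLeft_lt hxN (show M - r < M + 1 by omega) (show M - c < x by omega)
    rw [mdLabel_right hxN hc, hM]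
    rw [← Nat.cast_pow]
    omega
  have hrows : ∑ r ∈ Finset.range (M + 1), ((mdLabel (M + 1) x r M : ℤ) - mdLabel (M + 1) x r 0) =
      ((M + 1 : ℕ) : ℤ) * (((M + 1 : ℕ) : ℤ) ^ 2 - 1) -
        2 * ∑ r ∈ Finset.range (M + 1), (mdLeft (M + 1) x r 0 : ℤ) := by
    have h1 : ∑ r ∈ Finset.range (M + 1), (mdLabel (M + 1) x r M : ℤ) =
        ∑ r ∈ Finset.range (M + 1),
          (((M + 1 : ℕ) : ℤ) ^ 2 - 1 - mdLeft (M + 1) x (M + 1 - 1 - r) 0) :=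
      Finset.sum_congr rfl fun r hr => by
        rw [Finset.mem_range] at hr
        rw [hmirror r M (by omega) le_rfl (by omega), Nat.sub_self, hM]
    rw [Finset.sum_sub_distrib, h1, Finset.sum_sub_distrib,
      Finset.sum_range_reflect fun r => (mdLeft (M + 1) x r 0 : ℤ), Finset.sum_const,
      Finset.card_range, nsmul_eq_mul]
    simp_rw [mdLabel_left hx]
    ring
  have hcols : ∑ c ∈ Finset.range (M + 1), ((mdLabel (M + 1) x M c : ℤ) - mdLabel (M + 1) x 0 c) =
      2 * (∑ c ∈ Finset.range x, (mdLeft (M + 1) x M c : ℤ) -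
        ∑ c ∈ Finset.range x, (mdLeft (M + 1) x 0 c : ℤ)) +
      (((M + 1 : ℕ) : ℤ) - 2 * x) * (((M + 1 : ℕ) : ℤ) - 1) := by
    obtain ⟨d, hd⟩ : ∃ d, M + 1 = x + d + x := ⟨M + 1 - 2 * x, by omega⟩
    have h1 : ∑ c ∈ Finset.range x, ((mdLabel (M + 1) x M c : ℤ) - mdLabel (M + 1) x 0 c) =
        ∑ c ∈ Finset.range x, ((mdLeft (M + 1) x M c : ℤ) - mdLeft (M + 1) x 0 c) :=
      Finset.sum_congr rfl fun c hc => by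
        rw [Finset.mem_range] at hc
        rw [mdLabel_left hc, mdLabel_left hc]
    have h2 : ∑ i ∈ Finset.range d,
        ((mdLabel (M + 1) x M (x + i) : ℤ) - mdLabel (M + 1) x 0 (x + i)) = d * M := by
      rw [Finset.sum_congr rfl fun i hi => show _ = (M : ℤ) by
        rw [Finset.mem_range] at hi
        rw [mdLabel_middle (by omega) (by omega), mdLabel_middle (by omega) (by omega)]
        push_cast; ring]
      simp
    have h3 : ∑ i ∈ Finset.range x,
        ((mdLabel (M + 1) x M (x + d + i) : ℤ) - mdLabel (M + 1) x 0 (x + d + i)) =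
        ∑ c ∈ Finset.range x, ((mdLeft (M + 1) x M c : ℤ) - mdLeft (M + 1) x 0 c) := by
      rw [← Finset.sum_range_reflect]
      refine Finset.sum_congr rfl fun i hi => ?_
      rw [Finset.mem_range] at hi
      rw [hmirror M _ (by omega) (by omega) le_rfl, hmirror 0 _ (by omega) (by omega) (by omega),
        show M - (x + d + (x - 1 - i)) = i by omega, Nat.sub_self, Nat.sub_zero]
      ring
    conv_lhs => rw [hd, Finset.sum_range_add, Finset.sum_range_add, ← hd]
    rw [h1, h2, h3, Finset.sum_sub_distrib]
    have : (d : ℤ) = ((M + 1 : ℕ) : ℤ) - 2 * x := by omega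
    rw [this]
    push_cast
    ring
  rw [hrows, hcols, hM]
  ring

/-- The real number being rounded is the critical point of the cubic `sideCost`, whence the constant
`4 / 3`. Integer optimality involves `2N² - 2N + 1` instead; the surplus `1 / 3` is harmless since
integers are compared. -/
theorem mdSide_spec {N : ℕ} (hN : 2 ≤ N) : 1 ≤ mdSide N ∧ 2 * mdSide N ≤ N ∧
    (2 * (N : ℤ) - 1 - 2 * mdSide N) ^ 2 ≤ 2 * (N : ℤ) ^ 2 - 2 * N + 1 ∧
    2 * (N : ℤ) ^ 2 - 2 * N + 1 ≤ (2 * (N : ℤ) + 1 - 2 * mdSide N) ^ 2 := by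
  have hN' : (2 : ℝ) ≤ N := by exact_mod_cast hN
  set A : ℝ := 2 * (N : ℝ) ^ 2 - 2 * N + 4 / 3 with hA
  have hA0 : 0 ≤ A := by nlinarith
  have hs0 := Real.sqrt_nonneg A
  have hs2 := Real.sq_sqrt hA0
  set m : ℤ := round ((N : ℝ) - 1 / 2 * √A) with hm
  have hmeq : m = ⌊(N : ℝ) - 1 / 2 * √A + 1 / 2⌋ := round_eq _
  have hle : (m : ℝ) ≤ (N : ℝ) - 1 / 2 * √A + 1 / 2 := hmeq ▸ Int.floor_le _
  have hlt : (N : ℝ) - 1 / 2 * √A + 1 / 2 < m + 1 := hmeq ▸ Int.lt_floor_add_one _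
  have hm1 : 1 ≤ m := by
    rw [hmeq, Int.le_floor]
    have : √A ≤ 2 * N - 1 := Real.sqrt_le_iff.mpr ⟨by linarith, by nlinarith⟩
    push_cast
    linarith
  have hside : (mdSide N : ℤ) = m := Int.toNat_of_nonneg (show 0 ≤ m by omega)
  have hmN : 2 * m < N + 1 := by
    have : (N : ℝ) < √A := Real.lt_sqrt_of_sq_lt (by nlinarith)
    have : (2 * m : ℝ) < N + 1 := by linarith
    exact_mod_cast this
  have h1 : (2 * (N : ℤ) - 1 - 2 * m) ^ 2 ≤ 2 * (N : ℤ) ^ 2 - 2 * N + 1 := by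
    have h0 : (0 : ℝ) ≤ 2 * N - 1 - 2 * m := by
      have : (0 : ℤ) ≤ 2 * N - 1 - 2 * m := by omega
      exact_mod_cast this
    -- Rounding only bounds the square by the integer threshold plus `1 / 3`, which is less than the
    -- next integer.
    have : (2 * (N : ℝ) - 1 - 2 * m) ^ 2 < 2 * (N : ℝ) ^ 2 - 2 * N + 1 + 1 := by nlinarith
    exact Int.lt_add_one_iff.mp (by exact_mod_cast this)
  have h2 : 2 * (N : ℤ) ^ 2 - 2 * N + 1 ≤ (2 * (N : ℤ) + 1 - 2 * m) ^ 2 := by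
    have : 2 * (N : ℝ) ^ 2 - 2 * N + 1 ≤ (2 * (N : ℝ) + 1 - 2 * m) ^ 2 := by nlinarith
    exact_mod_cast this
  rw [← hside] at hm1 hmN h1 h2
  exact ⟨by omega, by omega, h1, h2⟩

theorem exists_isMitchisonDurbin (N : ℕ) :
    ∃ fM : Fin N × Fin N ≃ Fin (N ^ 2), IsMitchisonDurbin fM ∧
      ∀ f : Fin N × Fin N ≃ Fin (N ^ 2),
        edgesum (squareLattice N) fM ≤ edgesum (squareLattice N) f := by
  rcases lt_or_ge N 2 with hN | hN
  -- For `N < 2` there is a single enumeration; it only has to be checked that the side rounds to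
  -- zero, so that the pattern is well defined.
  · have hx : 2 * mdSide N ≤ N := by
      have hsqrt : (1 : ℝ) < √(2 * (N : ℝ) ^ 2 - 2 * N + 4 / 3) := by
        refine Real.lt_sqrt_of_sq_lt ?_
        interval_cases N <;> norm_num
      have hround : round ((N : ℝ) - 1 / 2 * √(2 * (N : ℝ) ^ 2 - 2 * N + 4 / 3)) < 1 := by
        have hN1 : (N : ℝ) ≤ 1 := by exact_mod_cast Nat.lt_succ_iff.mp hN
        rw [round_eq, Int.floor_lt]
        push_cast
        linarith
      rw [mdSide]
      omega
    obtain ⟨fM, hfM⟩ := exists_equiv_mdLabel hx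
    refine ⟨fM, hfM, fun f => ?_⟩
    have : Subsingleton (Fin (N ^ 2)) := by
      rw [Fin.subsingleton_iff_le_one]
      interval_cases N <;> norm_num
    rw [show f = fM from Equiv.ext fun z => Subsingleton.elim _ _]
  · obtain ⟨hx, hxN, h1, h2⟩ := mdSide_spec hN
    obtain ⟨fM, hfM⟩ := exists_equiv_mdLabel hxN
    refine ⟨fM, hfM, fun f => ?_⟩
    rw [edgesum_mdLabel hx hxN fM hfM]
    exact edgesum_ge_sideCost hN hxN h1 h2 f

theorem theorem1 (N : ℕ) :
    ∃ fM : Fin N × Fin N ≃ Fin (N ^ 2), IsMitchisonDurbin fM ∧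
      -- the transformation with the scheme `fM` minimises the average Pauli weight
      (∀ (c' : Fin N × Fin N → Fin N × Fin N → ℂ) (f : Fin N × Fin N ≃ Fin (N ^ 2)),
        averagePauliWeight (jordanWigner fM (fermionHamiltonian (squareLattice N) c')) ≤
          averagePauliWeight (jordanWigner f (fermionHamiltonian (squareLattice N) c'))) ∧
      -- `fM` solves the edgesum problem of the square lattice
      (∀ f : Fin N × Fin N ≃ Fin (N ^ 2),
        edgesum (squareLattice N) fM ≤ edgesum (squareLattice N) f) ∧
      -- the two optimisation problems are equivalent
      (∀ (c' : Fin N × Fin N → Fin N × Fin N → ℂ) (f : Fin N × Fin N ≃ Fin (N ^ 2)),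
        (∀ g : Fin N × Fin N ≃ Fin (N ^ 2),
          averagePauliWeight (jordanWigner f (fermionHamiltonian (squareLattice N) c')) ≤
            averagePauliWeight (jordanWigner g (fermionHamiltonian (squareLattice N) c'))) ↔
        (∀ g : Fin N × Fin N ≃ Fin (N ^ 2),
          edgesum (squareLattice N) f ≤ edgesum (squareLattice N) g)) := by
  obtain ⟨fM, hfM, hmin⟩ := exists_isMitchisonDurbin N
  refine ⟨fM, hfM, fun c' f => ?_, hmin, fun c' f => ?_⟩
  · exact (averagePauliWeight_le_iff fM f _ c').mpr (hmin f)
  · exact forall_congr' fun g => averagePauliWeight_le_iff f g _ c'
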